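/- Let $G$ be a finite-dimensional real Lie group with Lie algebra $\mathfrak g$, and let $\langle-,-\rangle$ be an $\mathrm{Ad}$-invariant symmetric bilinear form on $\mathfrak g$ (for example, $G$ compact, simply connected and semi-simple, and $\langle-,-\rangle$ the standard normalised invariant inner product). Put $P_0G=\{p\in C^\infty([0,1],G)\mid p(0)=1\}$ and $L_0G=\{p\in P_0G\mid p(1)=1\}$ with pointwise products. Let $P_0L_0G$ be the group of smooth maps $f:[0,1]^2\to G$, $(s,r)\mapsto f(s,r)$, with $f(0,r)=f(s,0)=f(s,1)=1$ (based paths, with path parameter $s$, of based loops, with loop parameter $r$). Let $\flat:P_0L_0G\to L_0G$, $\flat(f)=f(1,\cdot)$, and $L_0L_0G=\ker\flat$. Let $\omega$ be the left-invariant 2-form on $L_0G$ with $\omega(\beta_1,\beta_2)=\frac{\mathrm i}{2\pi}\int_0^1\langle\beta_1(r),\partial_r\beta_2(r)\rangle\,\mathrm dr$ at the identity, and for $g\in P_0G$ let $\xi_g$ be the left-invariant 1-form on $L_0G$ with $\xi_g(\beta)=\frac{\mathrm i}{2\pi}\int_0^1\langle\beta(r),g(r)^{-1}\partial_rg(r)\rangle\,\mathrm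 dr$. Set $$c(f_1,f_2)=\exp\Big(-\tfrac{\mathrm i}{2\pi}\int_0^1\mathrm dr\int_0^1\mathrm ds\,\big\langle f_1^{-1}\partial_sf_1,\ (\partial_rf_2)f_2^{-1}\big\rangle\Big),\qquad (f_1,z_1)(f_2,z_2)=\big(f_1f_2,\ z_1z_2\,c(f_1,f_2)\big)$$ on $P_0L_0G\times U(1)$. Let $N\subseteq P_0L_0G\times U(1)$ be the set of all $(f,z)$ with $f\in L_0L_0G$ and $z=\exp\big(\int_{D_f}\omega\big)$ for some disc $D_f$ in $L_0G$ with boundary $f$, that is, for some smooth null-homotopy $D_f:[0,1]^2\to L_0G$, $(\tau,s)\mapsto D_f(\tau,s)$, with $D_f(1,s)=f(s,\cdot)$ and $D_f=1$ on the other three sides of the square, oriented by $\mathrm d\tau\wedge\mathrm ds$. For $g\in P_0G$ put $$g\rhd(f,z)=\Big(gfg^{-1},\ z\exp\Big(\int_0^1\xi_g\big(f^{-1}(s)\,\partial_sf(s)\big)\,\mathrm ds\Big)\Big),\qquad (gfg^{-1})(s,r)=g(r)f(s,r)g(r)^{-1}.$$ Then: 1. $g\rhd(f,z)=\big(gfg^{-1},\,z\exp\big(\tfrac{\mathrm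 i}{2\pi}\int_0^1\mathrm dr\int_0^1\mathrm ds\,\langle f^{-1}\partial_sf,\ g^{-1}\partial_rg\rangle\big)\big)$ for all $g\in P_0G$ and $(f,z)\in P_0L_0G\times U(1)$. 2. The above product makes $P_0L_0G\times U(1)$ a group, and $\rhd$ is compatible with it: it is an action of $P_0G$ on this group by automorphisms. 3. $N$ is a normal subgroup of $P_0L_0G\times U(1)$, and $g\rhd N\subseteq N$ for all $g\in P_0G$. Hence $\rhd$ descends to an action of $P_0G$ by automorphisms on $(P_0L_0G\times U(1))/N$. 4. $\mathsf t([(f,z)])=\flat(f)\in L_0G\subseteq P_0G$ is a well-defined group homomorphism $(P_0L_0G\times U(1))/N\to P_0G$, and, together with the induced action, it satisfies the crossed module conditions $$\mathsf t(g\rhd h)=g\,\mathsf t(h)\,g^{-1},\qquad \mathsf t(h_1)\rhd h_2=h_1h_2h_1^{-1}\quad\text{(Peiffer identity)}$$ for all $g\in P_0G$ and all $h,h_1,h_2\in(P_0L_0G\times U(1))/N$. -/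

import Mathlib

open scoped Manifold ContDiff
open MeasureTheory

noncomputable section

namespace StringTwoGroup

/-! ### Smooth maps from `[0,1]`, `[0,1]²`, `[0,1]³`

Maps are defined on `unitInterval`; they are extended to `ℝ` by the projection onto `[0,1]` in order
to speak of smoothness on `[0,1]ᵏ ⊆ ℝᵏ` and of one-sided derivatives. -/

/-- A point of `[0,1]` from a real number. -/
abbrev pr (x : ℝ) : unitInterval := Set.projIcc (0 : ℝ) 1 zero_le_one x

section

variable (E : Type*) [NormedAddCommGroup E] [NormedSpace ℝ E]
  {G : Type*} [TopologicalSpace G] [ChartedSpace E G]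

/-- `p ∈ C^∞([0,1], G)`. -/
def Smooth₁ (p : unitInterval → G) : Prop :=
  ContMDiffOn 𝓘(ℝ, ℝ) 𝓘(ℝ, E) ∞ (fun x : ℝ => p (pr x)) (Set.Icc 0 1)

/-- `f ∈ C^∞([0,1]², G)`. -/
def Smooth₂ (f : unitInterval → unitInterval → G) : Prop :=
  ContMDiffOn 𝓘(ℝ, ℝ × ℝ) 𝓘(ℝ, E) ∞ (fun x : ℝ × ℝ => f (pr x.1) (pr x.2))
    (Set.Icc 0 1 ×ˢ Set.Icc 0 1)

/-- `D ∈ C^∞([0,1]³, G)`. -/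
def Smooth₃ (D : unitInterval → unitInterval → unitInterval → G) : Prop :=
  ContMDiffOn 𝓘(ℝ, ℝ × ℝ × ℝ) 𝓘(ℝ, E) ∞
    (fun x : ℝ × ℝ × ℝ => D (pr x.1) (pr x.2.1) (pr x.2.2))
    (Set.Icc 0 1 ×ˢ Set.Icc 0 1 ×ˢ Set.Icc 0 1)

variable {E}

lemma Smooth₂.end {f : unitInterval → unitInterval → G} (hf : Smooth₂ E f) :
    Smooth₁ E (f 1) := by
  have h1 : ContMDiff 𝓘(ℝ, ℝ) 𝓘(ℝ, ℝ × ℝ) ∞ (fun r : ℝ => ((1 : ℝ), r)) :=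
    (contDiff_const.prodMk contDiff_id).contMDiff
  have h2 := ContMDiffOn.comp (t := Set.Icc 0 1 ×ˢ Set.Icc 0 1) hf
    (h1.contMDiffOn (s := Set.Icc 0 1))
    (fun r hr => ⟨⟨zero_le_one, le_rfl⟩, hr⟩)
  refine h2.congr fun r _ => ?_
  simp [pr]

lemma Smooth₁.const_left {p : unitInterval → G} (hp : Smooth₁ E p) :
    Smooth₂ E (fun _ r => p r) := by
  have h1 : ContMDiff 𝓘(ℝ, ℝ × ℝ) 𝓘(ℝ, ℝ) ∞ (fun x : ℝ × ℝ => x.2) := contDiff_snd.contMDiff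
  have h2 := ContMDiffOn.comp (g := fun r : ℝ => p (pr r)) (t := Set.Icc 0 1) hp
    (h1.contMDiffOn (s := Set.Icc 0 1 ×ˢ Set.Icc 0 1)) (fun x hx => hx.2)
  exact h2

end

section

variable (E : Type*) [NormedAddCommGroup E] [NormedSpace ℝ E]
  (G : Type*) [TopologicalSpace G] [ChartedSpace E G] [Group G] [LieGroup 𝓘(ℝ, E) ∞ G]

/-- The based path group `P₀G`, with pointwise product. -/
def P₀ : Subgroup (unitInterval → G) where
  carrier := {p | Smooth₁ E p ∧ p 0 = 1}
  mul_mem' {p q} hp hq := ⟨ContMDiffOn.mul hp.1 hq.1, by simp [hp.2, hq.2]⟩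
  one_mem' := ⟨contMDiffOn_const, rfl⟩
  inv_mem' {p} hp := ⟨ContMDiffOn.inv hp.1, by simp [hp.2]⟩

/-- The based loop group `L₀G`. -/
def L₀ : Subgroup (unitInterval → G) where
  carrier := {p | p ∈ P₀ E G ∧ p 1 = 1}
  mul_mem' {p q} hp hq := ⟨mul_mem hp.1 hq.1, by simp [hp.2, hq.2]⟩
  one_mem' := ⟨one_mem _, rfl⟩
  inv_mem' {p} hp := ⟨inv_mem hp.1, by simp [hp.2]⟩

lemma L₀_le_P₀ : L₀ E G ≤ P₀ E G := fun _ h => h.1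

/-- The based path group `P₀L₀G` of the based loop group: smooth maps `f (s, r)` on `[0,1]²`, with
path parameter `s` and loop parameter `r`, such that `f (0, ·) = 1` and every `f (s, ·)` is a loop
based at `1`. The product is pointwise. -/
def P₀L₀ : Subgroup (unitInterval → unitInterval → G) where
  carrier := {f | Smooth₂ E f ∧ (∀ r, f 0 r = 1) ∧ (∀ s, f s 0 = 1) ∧ ∀ s, f s 1 = 1}
  mul_mem' {f h} hf hh := ⟨ContMDiffOn.mul hf.1 hh.1, by simp [hf.2.1, hh.2.1],
    by simp [hf.2.2.1, hh.2.2.1], by simp [hf.2.2.2, hh.2.2.2]⟩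
  one_mem' := ⟨contMDiffOn_const, fun _ => rfl, fun _ => rfl, fun _ => rfl⟩
  inv_mem' {f} hf := ⟨ContMDiffOn.inv hf.1, by simp [hf.2.1], by simp [hf.2.2.1],
    by simp [hf.2.2.2]⟩

/-- Endpoint evaluation `♭ : P₀L₀G → L₀G`, `♭(f) = f (1, ·)`. -/
def flat : P₀L₀ E G →* L₀ E G where
  toFun f := ⟨f.1 1, ⟨f.2.1.end, f.2.2.2.1 1⟩, f.2.2.2.2 1⟩
  map_one' := rfl
  map_mul' _ _ := rfl

variable {E G}

/-- Pointwise conjugation of `f ∈ P₀L₀G` by `g ∈ P₀G`: `(g f g⁻¹)(s, r) = g(r) f(s, r) g(r)⁻¹`. -/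
def conj (g : P₀ E G) (f : P₀L₀ E G) : P₀L₀ E G :=
  ⟨fun s r => g.1 r * f.1 s r * (g.1 r)⁻¹,
    ContMDiffOn.mul (ContMDiffOn.mul g.2.1.const_left f.2.1) (ContMDiffOn.inv g.2.1.const_left),
    by simp [f.2.2.1], by simp [f.2.2.2.1], by simp [f.2.2.2.2]⟩

end

/-! ### Logarithmic derivatives and the invariant form -/

section

variable {E : Type*} [NormedAddCommGroup E] [NormedSpace ℝ E]
  {G : Type*} [TopologicalSpace G] [ChartedSpace E G] [Group G]

/-- The adjoint action `Ad_g : 𝔤 → 𝔤`, the derivative of `x ↦ g x g⁻¹` at `1`. -/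
def Ad (g : G) (X : GroupLieAlgebra 𝓘(ℝ, E) G) : GroupLieAlgebra 𝓘(ℝ, E) G :=
  mfderiv 𝓘(ℝ, E) 𝓘(ℝ, E) (fun x : G => g * x * g⁻¹) 1 X

/-- `⟨Ad_g X, Ad_g Y⟩ = ⟨X, Y⟩`. -/
def AdInvariant (B : LinearMap.BilinForm ℝ (GroupLieAlgebra 𝓘(ℝ, E) G)) : Prop :=
  ∀ (g : G) (X Y : GroupLieAlgebra 𝓘(ℝ, E) G), B (Ad g X) (Ad g Y) = B X Y

/-- `p(t)⁻¹ p'(t) ∈ 𝔤`, the derivative at `u = t` of `u ↦ p(t)⁻¹ p(u)`, `u ∈ [0,1]`. -/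
def leftLog (p : unitInterval → G) (t : ℝ) : GroupLieAlgebra 𝓘(ℝ, E) G :=
  mfderivWithin 𝓘(ℝ, ℝ) 𝓘(ℝ, E) (fun u : ℝ => (p (pr t))⁻¹ * p (pr u)) (Set.Icc 0 1) t (1 : ℝ)

/-- `p'(t) p(t)⁻¹ ∈ 𝔤`, the derivative at `u = t` of `u ↦ p(u) p(t)⁻¹`, `u ∈ [0,1]`. -/
def rightLog (p : unitInterval → G) (t : ℝ) : GroupLieAlgebra 𝓘(ℝ, E) G :=
  mfderivWithin 𝓘(ℝ, ℝ) 𝓘(ℝ, E) (fun u : ℝ => p (pr u) * (p (pr t))⁻¹) (Set.Icc 0 1) t (1 : ℝ)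

/-- Derivative on `[0,1]` of a curve in the vector space `𝔤`. -/
def algDeriv (β : ℝ → GroupLieAlgebra 𝓘(ℝ, E) G) (t : ℝ) : GroupLieAlgebra 𝓘(ℝ, E) G :=
  derivWithin (F := E) β (Set.Icc 0 1) t

variable (B : LinearMap.BilinForm ℝ (GroupLieAlgebra 𝓘(ℝ, E) G))

/-! Elements of `𝔲(1) = iℝ` are represented by their real coefficient of `i`, so that the
exponential `𝔲(1) → U(1)` is `Circle.exp`, `x ↦ exp(i x)`. -/

/-- The Kac–Moody cocycle on `L₀𝔤`, `ω(β₁, β₂) = (i/2π) ∫₀¹ ⟨β₁(r), ∂_r β₂(r)⟩ dr`. -/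
def omega (β₁ β₂ : ℝ → GroupLieAlgebra 𝓘(ℝ, E) G) : ℝ :=
  1 / (2 * Real.pi) * ∫ r in (0 : ℝ)..1, B (β₁ r) (algDeriv β₂ r)

/-- The integral over a disc `D(τ, s) ∈ L₀G`, `(τ, s) ∈ [0,1]²`, of the left-invariant `2`-form on
`L₀G` with value `omega` at the identity. -/
def discIntegral (D : unitInterval → unitInterval → unitInterval → G) : ℝ :=
  ∫ τ in (0 : ℝ)..1, ∫ s in (0 : ℝ)..1,
    omega B (fun r => leftLog (fun τ' => D τ' (pr s) (pr r)) τ)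
      (fun r => leftLog (fun s' => D (pr τ) s' (pr r)) s)

/-- The left-invariant `1`-form `ξ_g` on `L₀G`, evaluated on `β ∈ L₀𝔤`:
`ξ_g(β) = (i/2π) ∫₀¹ ⟨β(r), g(r)⁻¹ g'(r)⟩ dr`. -/
def xi (g : unitInterval → G) (β : ℝ → GroupLieAlgebra 𝓘(ℝ, E) G) : ℝ :=
  1 / (2 * Real.pi) * ∫ r in (0 : ℝ)..1, B (β r) (leftLog g r)

/-- The group cocycle
`c(f₁, f₂) = exp(-(i/2π) ∫₀¹dr ∫₀¹ds ⟨f₁⁻¹ ∂_s f₁, (∂_r f₂) f₂⁻¹⟩)`. -/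
def cocycle (f₁ f₂ : unitInterval → unitInterval → G) : Circle :=
  Circle.exp (-(1 / (2 * Real.pi)) * ∫ r in (0 : ℝ)..1, ∫ s in (0 : ℝ)..1,
    B (leftLog (fun s' => f₁ s' (pr r)) s) (rightLog (fun r' => f₂ (pr s) r') r))

end

/-! ### The extension, the subset `N` and the action -/

/-- The set `P₀L₀G × U(1)` (a type of its own, because the product of groups `P₀L₀G × U(1)` carries
the untwisted product). -/
@[ext]
structure Ext (E : Type*) [NormedAddCommGroup E] [NormedSpace ℝ E]
    (G : Type*) [TopologicalSpace G] [ChartedSpace E G] [Group G] [LieGroup 𝓘(ℝ, E) ∞ G] where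
  /-- the component in `P₀L₀G` -/
  path : P₀L₀ E G
  /-- the component in `U(1)` -/
  phase : Circle

section

variable {E : Type*} [NormedAddCommGroup E] [NormedSpace ℝ E]
  {G : Type*} [TopologicalSpace G] [ChartedSpace E G] [Group G] [LieGroup 𝓘(ℝ, E) ∞ G]

/-- `D` is a disc in `L₀G` with boundary the based loop `f` of `L₀G`, parametrised as a smooth
null-homotopy: `D(0, s) = 1`, `D(1, s) = f(s)`, `D(τ, 0) = D(τ, 1) = 1`. -/
structure IsDisc (D : unitInterval → unitInterval → unitInterval → G)
    (f : unitInterval → unitInterval → G) : Prop where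
  smooth : Smooth₃ E D
  loop_zero : ∀ τ s, D τ s 0 = 1
  loop_one : ∀ τ s, D τ s 1 = 1
  base : ∀ s r, D 0 s r = 1
  boundary : ∀ s r, D 1 s r = f s r
  left : ∀ τ r, D τ 0 r = 1
  right : ∀ τ r, D τ 1 r = 1

variable (B : LinearMap.BilinForm ℝ (GroupLieAlgebra 𝓘(ℝ, E) G))

/-- The product `(f₁, z₁)(f₂, z₂) = (f₁ f₂, z₁ z₂ c(f₁, f₂))`. -/
def extMul (x y : Ext E G) : Ext E G :=
  ⟨x.path * y.path, x.phase * y.phase * cocycle B x.path.1 y.path.1⟩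

/-- The set `N` of pairs `(f, z)` with `f ∈ L₀L₀G` and `z = exp(∫_D ω)` for a disc `D` in `L₀G` with
boundary `f`. -/
def setN : Set (Ext E G) :=
  {x | flat E G x.path = 1 ∧ ∃ D : unitInterval → unitInterval → unitInterval → G,
    IsDisc (E := E) D x.path.1 ∧ x.phase = Circle.exp (discIntegral B D)}

/-- `g ▹ (f, z) = (g f g⁻¹, z exp(∫₀¹ ξ_g(f⁻¹(s) ∂_s f(s)) ds))`. -/
def extAct (g : P₀ E G) (x : Ext E G) : Ext E G :=
  ⟨conj g x.path, x.phase * Circle.exp (∫ s in (0 : ℝ)..1,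
    xi B g.1 (fun r => leftLog (fun s' => x.path.1 s' (pr r)) s))⟩

end

/-- A crossed module of groups `t : H → G`, with an action of `G` on `H` by automorphisms. -/
structure CrossedModule (H G : Type*) [Group H] [Group G] where
  /-- the homomorphism `t` -/
  t : H →* G
  /-- the action of `G` on `H` by automorphisms -/
  act : G →* MulAut H
  equivariant : ∀ g h, t (act g h) = g * t h * g⁻¹
  peiffer : ∀ h₁ h₂, act (t h₁) h₂ = h₁ * h₂ * h₁⁻¹

end StringTwoGroup

end

/-! The extension is embedded in a larger group. All boundary conditions are dropped and arbitrary
smooth maps of the square to `G` are extended by `U(1)` with the same cocycle (`SquareExt`). The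
exponent `pairing` is a real 2-cocycle by `Ad`-invariance (`pairing_cocycle`). The larger group
contains `Ext`, and also `P₀G` as the maps constant in `s`, lifted with phase 1 (`constExt`).
Conjugation by the latter is exactly the given action (`toSquareExt_extAct`), so associativity,
multiplicativity and the action laws are all inherited through injectivity of the embedding.

The analytic core is `kacMoodyIntegral_mul`, an identity of Polyakov–Wiegmann type: the integral of
the Kac–Moody form over a pointwise product of cubes is additive up to `pairing`s over the faces.
Pointwise, the defect is a sum of derivatives in the three coordinate directions
(`kacMoody_mul_pointwise`). This rests on the Maurer–Cartan equation, antisymmetry of the bracket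
and invariance of the form. For two discs only the face `τ = 1` contributes, and it contributes the
exponent of the cocycle, so the pairs (boundary, exponentiated integral) form a subgroup.
Multiplying a disc by cubes constant in `τ` shows that this subgroup is normal in the whole of
`SquareExt`. Normality of `N` and its stability under `P₀G` are two instances of this. Independence
of the integral from the disc is never needed, since `N` admits every disc.

For the Peiffer identity, let `x` lie over `f` and `a` over the path constantly equal to `f(1)`. The
path `f(s)⁻¹ f(1)` of `x⁻¹a` contracts to `1` through maps that are `1` at `s = 1`. At `s = 0` these
maps are unconstrained, but there the path of the other element `y` is `1`. The pointwise commutator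
of the homotopy with the path of `y` is therefore a disc, and its integral is the exponent of the
phase of the group commutator (`isDisc_commutator`). So `x` and `a` act alike on `y` modulo discs.
-/

noncomputable section

namespace StringTwoGroup

/-! ### Logarithmic derivatives of maps into a Lie group, in the chart at the identity. -/

section LogarithmicDerivative

open Filter Topology

variable {E : Type*} [NormedAddCommGroup E] [NormedSpace ℝ E]
  {G : Type*} [TopologicalSpace G] [ChartedSpace E G] [Group G]
  {V : Type*} [NormedAddCommGroup V] [NormedSpace ℝ V]
  {W : Type*} [NormedAddCommGroup W] [NormedSpace ℝ W]

variable (E G) in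
/-- The preferred chart of `G` at the identity. -/
def chartOne : PartialEquiv G E := extChartAt 𝓘(ℝ, E) (1 : G)

/-- `f x = 1`, and `f` has derivative `L` at `x` within `s`, read in the chart at the identity. -/
structure HasDerivToOne (f : V → G) (L : V →L[ℝ] E) (s : Set V) (x : V) : Prop where
  one : f x = 1
  cont : ContinuousWithinAt f s x
  deriv : HasFDerivWithinAt (fun y => chartOne E G (f y)) L s x

/-- The left logarithmic derivative of a map into `G`: the derivative of `y ↦ F(x)⁻¹ F(y)` at
`y = x`. -/
def maurerCartan (E : Type*) [NormedAddCommGroup E] [NormedSpace ℝ E] [ChartedSpace E G]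
    (s : Set V) (F : V → G) (x : V) : V →L[ℝ] E :=
  fderivWithin ℝ (fun y => chartOne E G ((F x)⁻¹ * F y)) s x

/-- The adjoint action as a continuous linear map, in the chart at the identity. -/
def AdL (E : Type*) [NormedAddCommGroup E] [NormedSpace ℝ E] [ChartedSpace E G]
    (g : G) : E →L[ℝ] E :=
  fderiv ℝ (fun a => chartOne E G (g * (chartOne E G).symm a * g⁻¹)) (chartOne E G 1)

lemma chartOne_symm_one : (chartOne E G).symm (chartOne E G 1) = 1 :=
  extChartAt_to_inv (I := 𝓘(ℝ, E)) (1 : G)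

lemma continuousAt_chartOne_symm : ContinuousAt (chartOne E G).symm (chartOne E G 1) :=
  continuousAt_extChartAt_symm (I := 𝓘(ℝ, E)) (1 : G)

lemma eventually_chartOne_symm_apply :
    ∀ᶠ g in 𝓝 (1 : G), (chartOne E G).symm (chartOne E G g) = g := by
  filter_upwards [extChartAt_source_mem_nhds (I := 𝓘(ℝ, E)) (1 : G)] with g hg
  exact (chartOne E G).left_inv hg

lemma eventually_chartOne_apply_symm :
    ∀ᶠ a in 𝓝 (chartOne E G 1), chartOne E G ((chartOne E G).symm a) = a := by
  filter_upwards [extChartAt_target_mem_nhds (I := 𝓘(ℝ, E)) (1 : G)] with a ha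
  exact (chartOne E G).right_inv ha

namespace HasDerivToOne

variable {f h : V → G} {L M : V →L[ℝ] E} {s t : Set V} {x : V}

lemma unique (hf : HasDerivToOne f L s x) (hf' : HasDerivToOne f M s x)
    (hs : UniqueDiffWithinAt ℝ s x) : L = M :=
  hs.eq hf.deriv hf'.deriv

lemma congr' (hf : HasDerivToOne f L s x) (hfh : h =ᶠ[𝓝[s] x] f) (hx : h x = f x) :
    HasDerivToOne h L s x :=
  ⟨hx.trans hf.one, hf.cont.congr_of_eventuallyEq hfh hx,
    hf.deriv.congr_of_eventuallyEq (hfh.fun_comp _) (by simp [hx])⟩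

lemma comp {ℓ : W → V} {ℓ' : W →L[ℝ] V} {u : Set W} {y : W} (hf : HasDerivToOne f L s (ℓ y))
    (hℓ : HasFDerivWithinAt ℓ ℓ' u y) (hu : Set.MapsTo ℓ u s) :
    HasDerivToOne (fun z => f (ℓ z)) (L.comp ℓ') u y :=
  ⟨hf.one, hf.cont.comp hℓ.continuousWithinAt hu, hf.deriv.comp y hℓ hu⟩

end HasDerivToOne

lemma contDiffWithinAt_chartOne {f : V → G} {s : Set V} {x : V}
    (hf : ContMDiffWithinAt 𝓘(ℝ, V) 𝓘(ℝ, E) ∞ f s x) (hx : f x = 1) :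
    ContDiffWithinAt ℝ ∞ (fun y => chartOne E G (f y)) s x := by
  have h1 : ContMDiffAt 𝓘(ℝ, E) 𝓘(ℝ, E) ∞ (chartOne E G) (f x) := by
    rw [hx]; exact contMDiffAt_extChartAt (I := 𝓘(ℝ, E))
  exact (h1.comp_contMDiffWithinAt x hf).contDiffWithinAt

/-- A map into `G` which is smooth at `x` with value `1` has a derivative in the chart. -/
lemma hasDerivToOne_fderivWithin {f : V → G} {s : Set V} {x : V}
    (hf : ContMDiffWithinAt 𝓘(ℝ, V) 𝓘(ℝ, E) ∞ f s x) (hx : f x = 1) :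
    HasDerivToOne f (fderivWithin ℝ (fun y => chartOne E G (f y)) s x) s x :=
  ⟨hx, hf.continuousWithinAt,
    ((contDiffWithinAt_chartOne hf hx).differentiableWithinAt (by simp)).hasFDerivWithinAt⟩

/-- A test map whose derivative is the identity: applying a rule to it and using uniqueness of
derivatives gives an identity of operators on `E`. -/
lemma hasDerivToOne_chartOne_symm :
    HasDerivToOne (chartOne E G).symm (ContinuousLinearMap.id ℝ E) Set.univ (chartOne E G 1) := by
  refine ⟨chartOne_symm_one, continuousAt_chartOne_symm.continuousWithinAt, ?_⟩
  refine ((hasFDerivAt_id _).congr_of_eventuallyEq ?_).hasFDerivWithinAt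
  exact eventually_chartOne_apply_symm

section

variable {s : Set V} {F H : V → G} {x : V}

lemma HasDerivToOne.maurerCartan_eq {L : V →L[ℝ] E}
    (h : HasDerivToOne (fun y => (F x)⁻¹ * F y) L s x) (hs : UniqueDiffWithinAt ℝ s x) :
    maurerCartan E s F x = L :=
  h.deriv.fderivWithin hs

lemma maurerCartan_const (g : G) : maurerCartan E s (fun _ : V => g) x = 0 := by
  simp [maurerCartan]

lemma maurerCartan_congr_set {t : Set V} (h : s =ᶠ[𝓝 x] t) :
    maurerCartan E s F x = maurerCartan E t F x :=
  fderivWithin_congr_set h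

lemma maurerCartan_congr (h : ∀ y ∈ s, F y = H y) (hx : x ∈ s) :
    maurerCartan E s F x = maurerCartan E s H x := by
  unfold maurerCartan
  rw [h x hx]
  exact fderivWithin_congr (fun y hy => by rw [h y hy]) (by rw [h x hx])

end

variable [LieGroup 𝓘(ℝ, E) ∞ G]

lemma isTopologicalGroup_of_lie (E : Type*) [NormedAddCommGroup E] [NormedSpace ℝ E]
    (G : Type*) [TopologicalSpace G] [ChartedSpace E G] [Group G] [LieGroup 𝓘(ℝ, E) ∞ G] :
    IsTopologicalGroup G :=
  topologicalGroup_of_lieGroup 𝓘(ℝ, E) ∞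

lemma contMDiffAt_chartOne_symm :
    ContMDiffAt 𝓘(ℝ, E) 𝓘(ℝ, E) ∞ (chartOne E G).symm (chartOne E G 1) :=
  (contMDiffOn_extChartAt_symm (I := 𝓘(ℝ, E)) (n := ∞) (1 : G)).contMDiffAt
    (extChartAt_target_mem_nhds (I := 𝓘(ℝ, E)) (1 : G))

/-- Multiplication in the chart at the identity has derivative `fst + snd`. -/
lemma hasFDerivAt_chartOne_mul :
    HasFDerivAt (fun p : E × E =>
      chartOne E G ((chartOne E G).symm p.1 * (chartOne E G).symm p.2))
      (ContinuousLinearMap.fst ℝ E E + ContinuousLinearMap.snd ℝ E E)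
      (chartOne E G 1, chartOne E G 1) := by
  set e := chartOne E G 1 with he
  set μ : E × E → E := fun p =>
      chartOne E G ((chartOne E G).symm p.1 * (chartOne E G).symm p.2) with hμ
  have hs : ContMDiffAt 𝓘(ℝ, E × E) 𝓘(ℝ, E) ∞
      (fun p : E × E => (chartOne E G).symm p.1 * (chartOne E G).symm p.2) (e, e) := by
    have h1 : ContMDiffAt 𝓘(ℝ, E × E) 𝓘(ℝ, E) ∞ (fun p : E × E => p.1) (e, e) :=
      contDiff_fst.contMDiff.contMDiffAt
    have h2 : ContMDiffAt 𝓘(ℝ, E × E) 𝓘(ℝ, E) ∞ (fun p : E × E => p.2) (e, e) :=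
      contDiff_snd.contMDiff.contMDiffAt
    have h3 : ContMDiffAt 𝓘(ℝ, E × E) 𝓘(ℝ, E) ∞
      (fun p : E × E => (chartOne E G).symm p.1) (e, e) :=
      ContMDiffAt.comp (e, e) (g := (chartOne E G).symm) contMDiffAt_chartOne_symm h1
    have h4 : ContMDiffAt 𝓘(ℝ, E × E) 𝓘(ℝ, E) ∞
      (fun p : E × E => (chartOne E G).symm p.2) (e, e) :=
      ContMDiffAt.comp (e, e) (g := (chartOne E G).symm) contMDiffAt_chartOne_symm h2
    exact h3.mul h4
  have hd : DifferentiableAt ℝ μ (e, e) := by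
    rw [← contMDiffWithinAt_univ] at hs
    have := contDiffWithinAt_chartOne hs (by simp [he, chartOne_symm_one])
    rw [contDiffWithinAt_univ] at this
    exact this.differentiableAt (by simp)
  have hM := hd.hasFDerivAt
  -- A linear map on `E × E` is determined on the two axes, and along each axis multiplication by
  -- `1` is the identity near `e`.
  have hl : (fderiv ℝ μ (e, e)).comp (ContinuousLinearMap.inl ℝ E E) =
      ContinuousLinearMap.id ℝ E := by
    have h1 : HasFDerivAt (fun a : E => μ (a, e))
        ((fderiv ℝ μ (e, e)).comp (ContinuousLinearMap.inl ℝ E E)) e :=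
      HasFDerivAt.comp (f := fun a : E => (a, e)) e hM (hasFDerivAt_prodMk_left e e)
    refine h1.unique ((hasFDerivAt_id e).congr_of_eventuallyEq ?_)
    filter_upwards [eventually_chartOne_apply_symm (E := E) (G := G)] with a ha
    simp [hμ, he, chartOne_symm_one, ha]
  have hr : (fderiv ℝ μ (e, e)).comp (ContinuousLinearMap.inr ℝ E E) =
      ContinuousLinearMap.id ℝ E := by
    have h1 : HasFDerivAt (fun a : E => μ (e, a))
        ((fderiv ℝ μ (e, e)).comp (ContinuousLinearMap.inr ℝ E E)) e :=
      HasFDerivAt.comp (f := fun a : E => (e, a)) e hM (hasFDerivAt_prodMk_right e e)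
    refine h1.unique ((hasFDerivAt_id e).congr_of_eventuallyEq ?_)
    filter_upwards [eventually_chartOne_apply_symm (E := E) (G := G)] with a ha
    simp [hμ, he, chartOne_symm_one, ha]
  convert hM using 1
  ext v
  · simpa using (DFunLike.congr_fun hl v).symm
  · simpa using (DFunLike.congr_fun hr v).symm

lemma HasDerivToOne.mul {f h : V → G} {L M : V →L[ℝ] E} {s : Set V} {x : V}
    (hf : HasDerivToOne f L s x) (hh : HasDerivToOne h M s x) :
    HasDerivToOne (fun y => f y * h y) (L + M) s x := by
  have := isTopologicalGroup_of_lie E G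
  refine ⟨by simp [hf.one, hh.one], hf.cont.mul hh.cont, ?_⟩
  have h1 : HasFDerivAt (fun p : E × E =>
      chartOne E G ((chartOne E G).symm p.1 * (chartOne E G).symm p.2))
      (ContinuousLinearMap.fst ℝ E E + ContinuousLinearMap.snd ℝ E E)
      (chartOne E G (f x), chartOne E G (h x)) := by
    rw [hf.one, hh.one]; exact hasFDerivAt_chartOne_mul
  have h2 := h1.comp_hasFDerivWithinAt x (hf.deriv.prodMk hh.deriv)
  have h3 : (ContinuousLinearMap.fst ℝ E E + ContinuousLinearMap.snd ℝ E E).comp (L.prod M) =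
      L + M := by ext; simp
  rw [h3] at h2
  refine h2.congr_of_eventuallyEq ?_ ?_
  · have e1 := hf.cont.tendsto.eventually
      (by rw [hf.one]; exact eventually_chartOne_symm_apply (E := E))
    have e2 := hh.cont.tendsto.eventually
      (by rw [hh.one]; exact eventually_chartOne_symm_apply (E := E))
    filter_upwards [e1, e2] with y h1 h2
    simp [h1, h2]
  · simp [hf.one, hh.one, chartOne_symm_one]

lemma hasFDerivAt_AdL (g : G) :
    HasFDerivAt (fun a => chartOne E G (g * (chartOne E G).symm a * g⁻¹)) (AdL E g)
      (chartOne E G 1) := by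
  refine DifferentiableAt.hasFDerivAt ?_
  have hs : ContMDiffWithinAt 𝓘(ℝ, E) 𝓘(ℝ, E) ∞
      (fun a => g * (chartOne E G).symm a * g⁻¹) Set.univ (chartOne E G 1) :=
    (contMDiffAt_const.mul contMDiffAt_chartOne_symm).mul contMDiffAt_const
  have := contDiffWithinAt_chartOne hs (by simp [chartOne_symm_one])
  rw [contDiffWithinAt_univ] at this
  exact this.differentiableAt (by simp)

lemma HasDerivToOne.conj {f : V → G} {L : V →L[ℝ] E} {s : Set V} {x : V}
    (hf : HasDerivToOne f L s x) (g : G) :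
    HasDerivToOne (fun y => g * f y * g⁻¹) ((AdL E g).comp L) s x := by
  have := isTopologicalGroup_of_lie E G
  refine ⟨by simp [hf.one], (continuousWithinAt_const.mul hf.cont).mul continuousWithinAt_const, ?_⟩
  have h1 : HasFDerivAt (fun a => chartOne E G (g * (chartOne E G).symm a * g⁻¹)) (AdL E g)
      (chartOne E G (f x)) := by
    rw [hf.one]; exact hasFDerivAt_AdL g
  refine (h1.comp_hasFDerivWithinAt x hf.deriv).congr_of_eventuallyEq ?_ ?_
  · have e1 := hf.cont.tendsto.eventually
      (by rw [hf.one]; exact eventually_chartOne_symm_apply (E := E))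
    filter_upwards [e1] with y h1
    simp [h1]
  · simp [hf.one, chartOne_symm_one]

@[simp] lemma AdL_one : AdL E (1 : G) = ContinuousLinearMap.id ℝ E := by
  have h := (hasDerivToOne_chartOne_symm (E := E) (G := G)).conj 1
  refine (h.congr' ?_ (by simp)).unique hasDerivToOne_chartOne_symm uniqueDiffWithinAt_univ
  exact Eventually.of_forall (by simp)

lemma AdL_mul (g h : G) : AdL E (g * h) = (AdL E g).comp (AdL E h) := by
  have h1 := (hasDerivToOne_chartOne_symm (E := E) (G := G)).conj (g * h)
  have h2 := ((hasDerivToOne_chartOne_symm (E := E) (G := G)).conj h).conj g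
  refine h1.unique (h2.congr' ?_ (by simp [mul_assoc])) uniqueDiffWithinAt_univ
  exact Eventually.of_forall (by simp [mul_assoc])

lemma AdL_mul_apply (g h : G) (X : E) : AdL E (g * h) X = AdL E g (AdL E h X) := by
  rw [AdL_mul]; rfl

@[simp] lemma AdL_inv_AdL (g : G) (X : E) : AdL E g⁻¹ (AdL E g X) = X := by
  rw [← AdL_mul_apply]; simp

@[simp] lemma AdL_AdL_inv (g : G) (X : E) : AdL E g (AdL E g⁻¹ X) = X := by
  rw [← AdL_mul_apply]; simp

/-! ### Rules for the logarithmic derivative -/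

section rules

variable {s : Set V} {F H : V → G} {x : V}

lemma hasDerivToOne_maurerCartan (hF : ContMDiffWithinAt 𝓘(ℝ, V) 𝓘(ℝ, E) ∞ F s x) :
    HasDerivToOne (fun y => (F x)⁻¹ * F y) (maurerCartan E s F x) s x :=
  hasDerivToOne_fderivWithin (contMDiffWithinAt_const.mul hF) (by simp)

/-- With `h = H x`, the quotient for the product factors as `h⁻¹ (F(x)⁻¹F(y)) h · h⁻¹H(y)`, a
conjugate times a map, both equal to `1` at `y = x`. -/
lemma maurerCartan_mul (hF : ContMDiffWithinAt 𝓘(ℝ, V) 𝓘(ℝ, E) ∞ F s x)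
    (hH : ContMDiffWithinAt 𝓘(ℝ, V) 𝓘(ℝ, E) ∞ H s x) (hs : UniqueDiffWithinAt ℝ s x) :
    maurerCartan E s (fun y => F y * H y) x =
      (AdL E (H x)⁻¹).comp (maurerCartan E s F x) + maurerCartan E s H x := by
  refine HasDerivToOne.maurerCartan_eq ?_ hs
  refine (((hasDerivToOne_maurerCartan hF).conj (H x)⁻¹).mul
    (hasDerivToOne_maurerCartan hH)).congr' (Eventually.of_forall fun y => ?_) ?_ <;>
  simp [mul_assoc]

lemma maurerCartan_inv (hF : ContMDiffWithinAt 𝓘(ℝ, V) 𝓘(ℝ, E) ∞ F s x)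
    (hs : UniqueDiffWithinAt ℝ s x) :
    maurerCartan E s (fun y => (F y)⁻¹) x = -(AdL E (F x)).comp (maurerCartan E s F x) := by
  have h := maurerCartan_mul hF hF.inv hs
  simp only [mul_inv_cancel, inv_inv, maurerCartan_const] at h
  exact (neg_eq_of_add_eq_zero_right h.symm).symm

lemma maurerCartan_comp {ℓ : W → V} {ℓ' : W →L[ℝ] V} {u : Set W} {y : W}
    (hF : ContMDiffWithinAt 𝓘(ℝ, V) 𝓘(ℝ, E) ∞ F s (ℓ y))
    (hℓ : HasFDerivWithinAt ℓ ℓ' u y) (hu : Set.MapsTo ℓ u s) (huy : UniqueDiffWithinAt ℝ u y) :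
    maurerCartan E u (fun z => F (ℓ z)) y = (maurerCartan E s F (ℓ y)).comp ℓ' :=
  HasDerivToOne.maurerCartan_eq ((hasDerivToOne_maurerCartan hF).comp hℓ hu) huy

/-- The logarithmic derivative is the partial derivative in the second variable, on the diagonal, of
`(a, b) ↦ F(a)⁻¹F(b)`. This map is `1` on the diagonal, so the single chart at the identity serves
every base point. -/
lemma contDiffOn_maurerCartan (hF : ContMDiffOn 𝓘(ℝ, V) 𝓘(ℝ, E) ∞ F s)
    (hs : UniqueDiffOn ℝ s) : ContDiffOn ℝ ∞ (maurerCartan E s F) s := by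
  intro x hx
  have h1 : ContMDiffWithinAt 𝓘(ℝ, V × V) 𝓘(ℝ, E) ∞ (fun p : V × V => (F p.1)⁻¹ * F p.2)
      (s ×ˢ s) (x, x) := by
    have a1 : ContMDiffWithinAt 𝓘(ℝ, V × V) 𝓘(ℝ, V) ∞ (fun p : V × V => p.1) (s ×ˢ s) (x, x) :=
      contDiff_fst.contMDiff.contMDiffAt.contMDiffWithinAt
    have a2 : ContMDiffWithinAt 𝓘(ℝ, V × V) 𝓘(ℝ, V) ∞ (fun p : V × V => p.2) (s ×ˢ s) (x, x) :=
      contDiff_snd.contMDiff.contMDiffAt.contMDiffWithinAt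
    have b1 := ContMDiffWithinAt.comp (x, x) (g := F) (t := s) (hF x hx) a1 (fun p hp => hp.1)
    have b2 := ContMDiffWithinAt.comp (x, x) (g := F) (t := s) (hF x hx) a2 (fun p hp => hp.2)
    exact b1.inv.mul b2
  have h2 := contDiffWithinAt_chartOne h1 (by simp)
  have h3 : ContDiffWithinAt ℝ ∞ (Function.uncurry fun a b => chartOne E G ((F a)⁻¹ * F b))
      ((insert x s) ×ˢ s) (x, id x) := by
    rw [Set.insert_eq_of_mem hx]; exact h2
  exact ContDiffWithinAt.fderivWithin' (g := id) h3 contDiffWithinAt_id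
    (by rw [Set.insert_eq_of_mem hx]; exact eventually_mem_nhdsWithin.mono hs) (by simp)
    (by simp)

lemma contDiffOn_AdL (hF : ContMDiffOn 𝓘(ℝ, V) 𝓘(ℝ, E) ∞ F s) :
    ContDiffOn ℝ ∞ (fun x => AdL E (F x)) s := by
  intro x hx
  set e := chartOne E G 1
  have h1 : ContMDiffWithinAt 𝓘(ℝ, V × E) 𝓘(ℝ, E) ∞
      (fun p : V × E => F p.1 * (chartOne E G).symm p.2 * (F p.1)⁻¹)
      (s ×ˢ Set.univ) (x, e) := by
    have a1 : ContMDiffWithinAt 𝓘(ℝ, V × E) 𝓘(ℝ, V) ∞ (fun p : V × E => p.1)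
      (s ×ˢ Set.univ) (x, e) :=
      contDiff_fst.contMDiff.contMDiffAt.contMDiffWithinAt
    have a2 : ContMDiffWithinAt 𝓘(ℝ, V × E) 𝓘(ℝ, E) ∞ (fun p : V × E => p.2)
      (s ×ˢ Set.univ) (x, e) :=
      contDiff_snd.contMDiff.contMDiffAt.contMDiffWithinAt
    have b1 := ContMDiffWithinAt.comp (x, e) (g := F) (t := s) (hF x hx) a1 (fun p hp => hp.1)
    have b2 := ContMDiffAt.comp_contMDiffWithinAt (x, e) (g := (chartOne E G).symm)
      contMDiffAt_chartOne_symm a2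
    exact (b1.mul b2).mul b1.inv
  have h2 := contDiffWithinAt_chartOne h1 (by simp [e, chartOne_symm_one])
  have h3 : ContDiffWithinAt ℝ ∞
      (Function.uncurry fun a b => chartOne E G (F a * (chartOne E G).symm b * (F a)⁻¹))
      ((insert x s) ×ˢ Set.univ) (x, (fun _ => e) x) := by
    rw [Set.insert_eq_of_mem hx]; exact h2
  have h4 := ContDiffWithinAt.fderivWithin' (g := fun _ => e) h3 contDiffWithinAt_const
    (n := ∞) (m := ∞) (by simp [uniqueDiffWithinAt_univ]) (by simp) (by simp)
  simp only [fderivWithin_univ] at h4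
  exact h4

end rules

end LogarithmicDerivative

/-! ### The Maurer–Cartan equation and antisymmetry of the bracket. -/

section MaurerCartanEquation

open Filter Topology

variable {E : Type*} [NormedAddCommGroup E] [NormedSpace ℝ E]
  {G : Type*} [TopologicalSpace G] [ChartedSpace E G] [Group G]
  {V : Type*} [NormedAddCommGroup V] [NormedSpace ℝ V]

/-- The differential at the identity of the adjoint representation. -/
def adL (E : Type*) [NormedAddCommGroup E] [NormedSpace ℝ E]
    (G : Type*) [TopologicalSpace G] [ChartedSpace E G] [Group G] : E →L[ℝ] E →L[ℝ] E :=
  fderiv ℝ (fun a => AdL E ((chartOne E G).symm a)) (chartOne E G 1)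

/-- If `F x = 1`, the logarithmic derivative is the derivative in the chart. -/
lemma maurerCartan_of_eq_one {F : V → G} {s : Set V} {x : V} (hx : F x = 1) :
    maurerCartan E s F x = fderivWithin ℝ (fun y => chartOne E G (F y)) s x := by
  simp [maurerCartan, hx]

variable [LieGroup 𝓘(ℝ, E) ∞ G]

lemma hasFDerivAt_AdL_chartOne_symm :
    HasFDerivAt (fun a => AdL E ((chartOne E G).symm a)) (adL E G) (chartOne E G 1) := by
  have h := contDiffOn_AdL (contMDiffOn_extChartAt_symm (I := 𝓘(ℝ, E)) (n := ∞) (1 : G))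
  exact ((h.contDiffAt (extChartAt_target_mem_nhds (I := 𝓘(ℝ, E)) (1 : G))).differentiableAt
    (by simp)).hasFDerivAt

/-- Factoring `Ad(F y) = Ad(F x) Ad(F(x)⁻¹F(y))` reduces the derivative of `Ad` at an arbitrary
point to its derivative at the identity. -/
lemma hasFDerivAt_AdL_apply {F : V → G} {x : V} (hF : ContMDiffAt 𝓘(ℝ, V) 𝓘(ℝ, E) ∞ F x)
    {Y : V → E} {Y' : V →L[ℝ] E} (hY : HasFDerivAt Y Y' x) :
    HasFDerivAt (fun y => AdL E (F y) (Y y))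
      ((AdL E (F x)).comp (((adL E G).flip (Y x)).comp (maurerCartan E Set.univ F x) + Y')) x := by
  have hM := hasDerivToOne_maurerCartan (s := Set.univ) hF
  have h1 : HasFDerivAt (fun a => AdL E ((chartOne E G).symm a)) (adL E G)
      (chartOne E G ((F x)⁻¹ * F x)) := by
    rw [inv_mul_cancel]; exact hasFDerivAt_AdL_chartOne_symm
  have h2 := h1.comp x (hasFDerivWithinAt_univ.1 hM.deriv)
  have h3 := (AdL E (F x)).hasFDerivAt.comp x (h2.clm_apply hY)
  refine (h3.congr_of_eventuallyEq ?_).congr_fderiv ?_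
  · have e1 := hM.cont.tendsto.eventually
      (by rw [hM.one]; exact eventually_chartOne_symm_apply (E := E))
    rw [nhdsWithin_univ] at e1
    filter_upwards [e1] with y hy
    simp only [Function.comp_apply, hy]
    rw [← AdL_mul_apply, mul_inv_cancel_left]
  · ext v
    simp [chartOne_symm_one, add_comm]

lemma differentiableAt_maurerCartan {F : V → G} {U : Set V} (hU : IsOpen U)
    (hF : ContMDiffOn 𝓘(ℝ, V) 𝓘(ℝ, E) ∞ F U) {x : V} (hx : x ∈ U) :
    DifferentiableAt ℝ (maurerCartan E Set.univ F) x := by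
  have h := ((contDiffOn_maurerCartan hF hU.uniqueDiffOn).contDiffAt
    (hU.mem_nhds hx)).differentiableAt (by simp)
  refine h.congr_of_eventuallyEq ?_
  filter_upwards [hU.mem_nhds hx] with y hy
  refine maurerCartan_congr_set ?_
  filter_upwards [hU.mem_nhds hy] with z hz
  exact propext ⟨fun _ => hz, fun _ => trivial⟩

/-- The Maurer-Cartan equation for a map on an open subset of the plane. -/
lemma maurerCartan_equation_plane {f : ℝ × ℝ → G} {U : Set (ℝ × ℝ)} (hU : IsOpen U)
    (hf : ContMDiffOn 𝓘(ℝ, ℝ × ℝ) 𝓘(ℝ, E) ∞ f U) {p : ℝ × ℝ} (hp : p ∈ U) :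
    fderiv ℝ (maurerCartan E Set.univ f) p (0, 1) (1, 0) =
      fderiv ℝ (maurerCartan E Set.univ f) p (1, 0) (0, 1) +
        adL E G (maurerCartan E Set.univ f p (1, 0)) (maurerCartan E Set.univ f p (0, 1)) := by
  obtain ⟨a, b⟩ := p
  have hfa : ∀ q ∈ U, ContMDiffAt 𝓘(ℝ, ℝ × ℝ) 𝓘(ℝ, E) ∞ f q :=
    fun q hq => hf.contMDiffAt (hU.mem_nhds hq)
  set A := maurerCartan E Set.univ f with hA
  have hz0 : ((0 : ℝ), (0 : ℝ)) = 0 := rfl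
  have hdA : DifferentiableAt ℝ A (a, b) := differentiableAt_maurerCartan hU hf hp
  -- the horizontal and vertical lines through the point
  have hv : ∀ q, HasFDerivAt (fun q : ℝ × ℝ => (a, q.2))
      ((0 : ℝ × ℝ →L[ℝ] ℝ).prod (ContinuousLinearMap.snd ℝ ℝ ℝ)) q :=
    fun q => (hasFDerivAt_const a q).prodMk hasFDerivAt_snd
  have hh : ∀ q, HasFDerivAt (fun q : ℝ × ℝ => (q.1, b))
      ((ContinuousLinearMap.fst ℝ ℝ ℝ).prod (0 : ℝ × ℝ →L[ℝ] ℝ)) q :=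
    fun q => hasFDerivAt_fst.prodMk (hasFDerivAt_const b q)
  have chv : ContMDiff 𝓘(ℝ, ℝ × ℝ) 𝓘(ℝ, ℝ × ℝ) ∞ (fun q : ℝ × ℝ => (a, q.2)) :=
    (contDiff_const.prodMk contDiff_snd).contMDiff
  have chh : ContMDiff 𝓘(ℝ, ℝ × ℝ) 𝓘(ℝ, ℝ × ℝ) ∞ (fun q : ℝ × ℝ => (q.1, b)) :=
    (contDiff_fst.prodMk contDiff_const).contMDiff
  -- the auxiliary maps
  set k : ℝ × ℝ → G := fun q => f q * (f (q.1, b))⁻¹ with hk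
  have sk : ∀ q, q ∈ U → (q.1, b) ∈ U → ContMDiffAt 𝓘(ℝ, ℝ × ℝ) 𝓘(ℝ, E) ∞ k q := fun q h1 h2 =>
    (hfa q h1).mul (ContMDiffAt.comp q (g := f) (f := fun q : ℝ × ℝ => (q.1, b)) (hfa _ h2)
      chh.contMDiffAt).inv
  -- Here `k` is `1` on the horizontal line through `(a, b)`, and `w` is `1` on both lines. On these
  -- lines the logarithmic derivative of `w` is thus the plain derivative of its chart expression
  -- `g`, to which symmetry of second derivatives applies.
  set w : ℝ × ℝ → G := fun q => (k (a, q.2))⁻¹ * k q with hw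
  have sw : ∀ q, q ∈ U → (q.1, b) ∈ U → (a, q.2) ∈ U →
      ContMDiffAt 𝓘(ℝ, ℝ × ℝ) 𝓘(ℝ, E) ∞ w q := fun q h1 h2 h3 =>
    (ContMDiffAt.comp q (g := k) (f := fun q : ℝ × ℝ => (a, q.2)) (sk _ h3 hp)
      chv.contMDiffAt).inv.mul (sk q h1 h2)
  have mk : ∀ q, q ∈ U → (q.1, b) ∈ U → ∀ v, maurerCartan E Set.univ k q v =
      AdL E (f (q.1, b)) (A q v - A (q.1, b) (v.1, 0)) := by
    intro q h1 h2 v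
    have c : ContMDiffAt 𝓘(ℝ, ℝ × ℝ) 𝓘(ℝ, E) ∞ (fun q : ℝ × ℝ => f (q.1, b)) q :=
      ContMDiffAt.comp q (g := f) (f := fun q : ℝ × ℝ => (q.1, b)) (hfa _ h2) chh.contMDiffAt
    rw [hk, maurerCartan_mul (hfa q h1) c.inv uniqueDiffWithinAt_univ,
      maurerCartan_inv c uniqueDiffWithinAt_univ,
      maurerCartan_comp (F := f) (s := Set.univ) (ℓ := fun q : ℝ × ℝ => (q.1, b)) (hfa _ h2) (hh q).hasFDerivWithinAt
        (Set.mapsTo_univ _ _) uniqueDiffWithinAt_univ]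
    simp [hA, sub_eq_add_neg]
  have mw : ∀ q, q ∈ U → (q.1, b) ∈ U → (a, q.2) ∈ U → ∀ v, maurerCartan E Set.univ w q v =
      AdL E (k q)⁻¹ (-AdL E (k (a, q.2)) (maurerCartan E Set.univ k (a, q.2) (0, v.2))) +
        maurerCartan E Set.univ k q v := by
    intro q h1 h2 h3 v
    have c : ContMDiffAt 𝓘(ℝ, ℝ × ℝ) 𝓘(ℝ, E) ∞ (fun q : ℝ × ℝ => k (a, q.2)) q :=
      ContMDiffAt.comp q (g := k) (f := fun q : ℝ × ℝ => (a, q.2)) (sk _ h3 hp) chv.contMDiffAt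
    rw [hw, maurerCartan_mul c.inv (sk q h1 h2) uniqueDiffWithinAt_univ,
      maurerCartan_inv c uniqueDiffWithinAt_univ,
      maurerCartan_comp (F := k) (s := Set.univ) (ℓ := fun q : ℝ × ℝ => (a, q.2)) (sk _ h3 hp) (hv q).hasFDerivWithinAt
        (Set.mapsTo_univ _ _) uniqueDiffWithinAt_univ]
    simp
  -- its expression in the chart
  set g : ℝ × ℝ → E := fun q => chartOne E G (w q) with hg
  have hg1 : ∀ q, w q = 1 → fderiv ℝ g q = maurerCartan E Set.univ w q := by
    intro q h1
    rw [maurerCartan_of_eq_one h1, fderivWithin_univ]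
  have hgC : ContDiffAt ℝ ∞ g (a, b) := by
    have := contDiffWithinAt_chartOne (s := Set.univ) (sw _ hp hp hp) (by simp [hw, hk])
    rwa [contDiffWithinAt_univ] at this
  have hgd : DifferentiableAt ℝ (fderiv ℝ g) (a, b) :=
    (hgC.fderiv_right (m := ∞) (by simp)).differentiableAt (by simp)
  have hsymm : fderiv ℝ (fderiv ℝ g) (a, b) (0, 1) (1, 0) =
      fderiv ℝ (fderiv ℝ g) (a, b) (1, 0) (0, 1) :=
    hgC.isSymmSndFDerivAt (by rw [minSmoothness_of_isRCLikeNormedField]; exact WithTop.coe_le_coe.2 le_top) _ _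
  have lv : HasFDerivAt (fun r : ℝ => (a, r)) (ContinuousLinearMap.inr ℝ ℝ ℝ) b :=
    hasFDerivAt_prodMk_right a b
  have lh : HasFDerivAt (fun s : ℝ => (s, b)) (ContinuousLinearMap.inl ℝ ℝ ℝ) a :=
    hasFDerivAt_prodMk_left a b
  have ev : ∀ᶠ r in 𝓝 b, (a, r) ∈ U :=
    lv.continuousAt.eventually (hU.mem_nhds hp)
  have eh : ∀ᶠ s in 𝓝 a, (s, b) ∈ U :=
    lh.continuousAt.eventually (hU.mem_nhds hp)
  -- On the vertical line the twist is the fixed operator `Ad(f(a,b))`, so only `A` is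
  -- differentiated.
  have d1 : fderiv ℝ (fderiv ℝ g) (a, b) (0, 1) (1, 0) =
      AdL E (f (a, b)) (fderiv ℝ A (a, b) (0, 1) (1, 0)) := by
    have u1 : HasFDerivAt (fun r : ℝ => fderiv ℝ g (a, r) (1, 0)) _ b :=
      (HasFDerivAt.comp (f := fun r : ℝ => (a, r)) b hgd.hasFDerivAt lv).clm_apply
        (hasFDerivAt_const (1, 0) b)
    have u2 : HasFDerivAt (fun r : ℝ => AdL E (f (a, b)) (A (a, r) (1, 0) - A (a, b) (1, 0))) _ b :=
      (AdL E (f (a, b))).hasFDerivAt.comp b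
        (((HasFDerivAt.comp (f := fun r : ℝ => (a, r)) b hdA.hasFDerivAt lv).clm_apply
        (hasFDerivAt_const (1, 0) b)).sub_const _)
    have u3 := u1.unique (u2.congr_of_eventuallyEq (by
      filter_upwards [ev] with r hr
      rw [hg1 (a, r) (by simp [hw]), mw _ hr hp hr, mk _ hr hp, mk _ hr hp]
      simp [hz0]))
    simpa using DFunLike.congr_fun u3 1
  -- On the horizontal line the twist `Ad(f(s,b))` varies with `s`; its derivative is the source of
  -- the bracket term.
  have d2 : fderiv ℝ (fderiv ℝ g) (a, b) (1, 0) (0, 1) =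
      AdL E (f (a, b)) (adL E G (A (a, b) (1, 0)) (A (a, b) (0, 1)) +
        fderiv ℝ A (a, b) (1, 0) (0, 1)) := by
    have u1 : HasFDerivAt (fun s : ℝ => fderiv ℝ g (s, b) (0, 1)) _ a :=
      (HasFDerivAt.comp (f := fun s : ℝ => (s, b)) a hgd.hasFDerivAt lh).clm_apply
        (hasFDerivAt_const (0, 1) a)
    have clh : ContMDiffAt 𝓘(ℝ, ℝ) 𝓘(ℝ, ℝ × ℝ) ∞ (fun s : ℝ => (s, b)) a :=
      (contDiff_id.prodMk contDiff_const).contMDiff.contMDiffAt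
    have u2 : HasFDerivAt (fun s : ℝ => AdL E (f (s, b)) (A (s, b) (0, 1)) -
        AdL E (f (a, b)) (A (a, b) (0, 1))) _ a :=
      (hasFDerivAt_AdL_apply (F := fun s : ℝ => f (s, b))
        (ContMDiffAt.comp a (g := f) (f := fun s : ℝ => (s, b)) (hfa _ hp) clh)
        ((HasFDerivAt.comp (f := fun s : ℝ => (s, b)) a hdA.hasFDerivAt lh).clm_apply
        (hasFDerivAt_const (0, 1) a))).sub_const _
    have u3 := u1.unique (u2.congr_of_eventuallyEq (by
      filter_upwards [eh] with s hs
      rw [hg1 (s, b) (by simp [hw, hk]), mw _ hs hs hp, mk _ hp hp, mk _ hs hs]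
      simp [hk, hz0, sub_eq_add_neg, add_comm]))
    have u4 := maurerCartan_comp (F := f) (s := Set.univ) (ℓ := fun s : ℝ => (s, b)) (hfa _ hp) lh.hasFDerivWithinAt
        (Set.mapsTo_univ _ _) uniqueDiffWithinAt_univ
    rw [u4] at u3
    simpa using DFunLike.congr_fun u3 1
  rw [d1, d2] at hsymm
  have := congrArg (AdL E (f (a, b))⁻¹) hsymm
  rw [AdL_inv_AdL, AdL_inv_AdL] at this
  rw [this, add_comm]

/-- The Maurer-Cartan equation. -/
lemma maurerCartan_equation {F : V → G} {U : Set V} (hU : IsOpen U)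
    (hF : ContMDiffOn 𝓘(ℝ, V) 𝓘(ℝ, E) ∞ F U) {x : V} (hx : x ∈ U) (v w : V) :
    fderiv ℝ (maurerCartan E Set.univ F) x w v =
      fderiv ℝ (maurerCartan E Set.univ F) x v w +
        adL E G (maurerCartan E Set.univ F x v) (maurerCartan E Set.univ F x w) := by
  -- The general case is the planar one for the pullback to the affine plane `(α, β) ↦ x + αv + βw`.
  set ℓ' : ℝ × ℝ →L[ℝ] V := (ContinuousLinearMap.fst ℝ ℝ ℝ).smulRight v +
    (ContinuousLinearMap.snd ℝ ℝ ℝ).smulRight w with hℓ'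
  set ℓ : ℝ × ℝ → V := fun q => x + ℓ' q with hℓ
  have dℓ : ∀ q, HasFDerivAt ℓ ℓ' q := fun q => ℓ'.hasFDerivAt.const_add x
  have cℓ : ContDiff ℝ ∞ ℓ := contDiff_const.add ℓ'.contDiff
  have hU' : IsOpen (ℓ ⁻¹' U) := hU.preimage cℓ.continuous
  have hF' : ContMDiffOn 𝓘(ℝ, ℝ × ℝ) 𝓘(ℝ, E) ∞ (fun q => F (ℓ q)) (ℓ ⁻¹' U) :=
    ContMDiffOn.comp (g := F) hF cℓ.contMDiff.contMDiffOn subset_rfl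
  have h0 : ℓ 0 = x := by simp [hℓ]
  have key := maurerCartan_equation_plane hU' hF' (p := 0) (by simp [h0, hx])
  have e1 : ∀ q ∈ ℓ ⁻¹' U, maurerCartan E Set.univ (fun q => F (ℓ q)) q =
      (maurerCartan E Set.univ F (ℓ q)).comp ℓ' := fun q hq =>
    maurerCartan_comp (s := Set.univ) (hF.contMDiffAt (hU.mem_nhds hq)) (dℓ q).hasFDerivWithinAt
      (Set.mapsTo_univ _ _) uniqueDiffWithinAt_univ
  have dA : DifferentiableAt ℝ (maurerCartan E Set.univ F) (ℓ 0) := by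
    rw [h0]; exact differentiableAt_maurerCartan hU hF hx
  have e2 : HasFDerivAt (maurerCartan E Set.univ (fun q => F (ℓ q))) _ 0 :=
    ((dA.hasFDerivAt.comp 0 (dℓ 0)).clm_comp (hasFDerivAt_const ℓ' 0)).congr_of_eventuallyEq
      (by filter_upwards [hU'.mem_nhds (by simp [h0, hx] : (0 : ℝ × ℝ) ∈ ℓ ⁻¹' U)] with q hq
          exact e1 q hq)
  rw [e2.fderiv, e1 0 (by simp [h0, hx])] at key
  simpa [h0, hℓ'] using key

/-- The inverse chart has logarithmic derivative the identity at the base point. Its Maurer–Cartan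
equation, written for `(X, Y)` and `(Y, X)`, exchanges the same two second-order terms, so the
brackets sum to zero. -/
lemma adL_antisymm (X Y : E) : adL E G X Y = -adL E G Y X := by
  have ho : IsOpen (chartOne E G).target := isOpen_extChartAt_target (I := 𝓘(ℝ, E)) (1 : G)
  have hF := contMDiffOn_extChartAt_symm (I := 𝓘(ℝ, E)) (n := ∞) (1 : G)
  have hm := mem_extChartAt_target (I := 𝓘(ℝ, E)) (1 : G)
  have h1 := maurerCartan_equation ho hF hm X Y
  have h2 := maurerCartan_equation ho hF hm Y X
  have h3 : maurerCartan E Set.univ (chartOne E G).symm (chartOne E G 1) =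
      ContinuousLinearMap.id ℝ E := by
    refine HasDerivToOne.maurerCartan_eq ?_ uniqueDiffWithinAt_univ
    simpa [chartOne_symm_one] using hasDerivToOne_chartOne_symm (E := E) (G := G)
  have e1 : extChartAt 𝓘(ℝ, E) (1 : G) = chartOne E G := rfl
  rw [e1, h3] at h1 h2
  rw [h2] at h1
  simp only [ContinuousLinearMap.id_apply, add_assoc] at h1
  exact eq_neg_of_add_eq_zero_right (left_eq_add.1 h1)

end MaurerCartanEquation

/-! ### The Kac–Moody integrand of a product. -/

section PointwiseIdentity

open Filter Topology

variable {E : Type*} [NormedAddCommGroup E] [NormedSpace ℝ E]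
  {G : Type*} [TopologicalSpace G] [ChartedSpace E G] [Group G]
  {V : Type*} [NormedAddCommGroup V] [NormedSpace ℝ V] [LieGroup 𝓘(ℝ, E) ∞ G]

variable {b : E →L[ℝ] E →L[ℝ] ℝ}

/-- Differentiate the constant function `a ↦ b (Ad_a Y) (Ad_a Z)` at the identity. -/
lemma invariant_adL (hb : ∀ (g : G) X Y, b (AdL E g X) (AdL E g Y) = b X Y) (X Y Z : E) :
    b (adL E G X Y) Z = -b Y (adL E G X Z) := by
  have h : ∀ Y, HasFDerivAt (fun a => AdL E ((chartOne E G).symm a) Y) _ (chartOne E G 1) :=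
    fun Y => hasFDerivAt_AdL_chartOne_symm.clm_apply (hasFDerivAt_const Y _)
  have h1 := b.hasFDerivAt_of_bilinear (h Y) (h Z)
  have h2 := h1.unique ((hasFDerivAt_const (b Y Z) _).congr_of_eventuallyEq
    (Eventually.of_forall fun a => hb _ Y Z))
  have h3 := DFunLike.congr_fun h2 X
  simp [chartOne_symm_one] at h3
  linarith

/-- The behaviour of the integrand of the Kac-Moody cocycle under pointwise products, up to
derivatives in the three directions. -/
lemma kacMoody_mul_pointwise (hs : ∀ X Y, b X Y = b Y X)
    (hb : ∀ (g : G) X Y, b (AdL E g X) (AdL E g Y) = b X Y)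
    {F H : V → G} {U : Set V} (hU : IsOpen U)
    (hF : ContMDiffOn 𝓘(ℝ, V) 𝓘(ℝ, E) ∞ F U) (hH : ContMDiffOn 𝓘(ℝ, V) 𝓘(ℝ, E) ∞ H U)
    {x : V} (hx : x ∈ U) (u v w : V) :
    b (maurerCartan E Set.univ (fun y => F y * H y) x u)
        (fderiv ℝ (maurerCartan E Set.univ (fun y => F y * H y)) x w v) =
      b (maurerCartan E Set.univ F x u) (fderiv ℝ (maurerCartan E Set.univ F) x w v) +
      b (maurerCartan E Set.univ H x u) (fderiv ℝ (maurerCartan E Set.univ H) x w v) +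
      fderiv ℝ (fun y => b (maurerCartan E Set.univ F y u)
        (AdL E (H y) (maurerCartan E Set.univ H y w))) x v -
      fderiv ℝ (fun y => b (maurerCartan E Set.univ F y v)
        (AdL E (H y) (maurerCartan E Set.univ H y w))) x u +
      fderiv ℝ (fun y => b (maurerCartan E Set.univ H y u)
        (AdL E (H y)⁻¹ (maurerCartan E Set.univ F y v))) x w := by
  have cF : ∀ y ∈ U, ContMDiffAt 𝓘(ℝ, V) 𝓘(ℝ, E) ∞ F y :=
    fun y hy => hF.contMDiffAt (hU.mem_nhds hy)
  have cH : ∀ y ∈ U, ContMDiffAt 𝓘(ℝ, V) 𝓘(ℝ, E) ∞ H y :=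
    fun y hy => hH.contMDiffAt (hU.mem_nhds hy)
  have mcA := fun p q => maurerCartan_equation hU hF hx p q
  have mcC := fun p q => maurerCartan_equation hU hH hx p q
  have dA := (differentiableAt_maurerCartan hU hF hx).hasFDerivAt
  have dC := (differentiableAt_maurerCartan hU hH hx).hasFDerivAt
  set A := maurerCartan E Set.univ F with hA
  set C := maurerCartan E Set.univ H with hC
  have dA' : ∀ p, HasFDerivAt (fun y => A y p) ((fderiv ℝ A x).flip p) x := fun p => by
    simpa using dA.clm_apply (hasFDerivAt_const p x)
  have dC' : ∀ p, HasFDerivAt (fun y => C y p) ((fderiv ℝ C x).flip p) x := fun p => by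
    simpa using dC.clm_apply (hasFDerivAt_const p x)
  have dR : ∀ p, HasFDerivAt (fun y => AdL E (H y) (C y p)) _ x := fun p =>
    hasFDerivAt_AdL_apply (cH x hx) (dC' p)
  have dQ : ∀ p, HasFDerivAt (fun y => AdL E (H y)⁻¹ (A y p)) _ x := fun p =>
    hasFDerivAt_AdL_apply (F := fun y => (H y)⁻¹) (cH x hx).inv (dA' p)
  have eP : ∀ y ∈ U, ∀ p, maurerCartan E Set.univ (fun y => F y * H y) y p =
      AdL E (H y)⁻¹ (A y p) + C y p := fun y hy p => by
    rw [maurerCartan_mul (cF y hy) (cH y hy) uniqueDiffWithinAt_univ]; rfl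
  have dP := (differentiableAt_maurerCartan (F := fun y => F y * H y) hU (hF.mul hH) hx).hasFDerivAt
  have dP' := dP.clm_apply (hasFDerivAt_const v x)
  have e1 := dP'.unique (((dQ v).add (dC' v)).congr_of_eventuallyEq
    (by filter_upwards [hU.mem_nhds hx] with y hy using eP y hy v))
  have e2 := DFunLike.congr_fun e1 w
  rw [maurerCartan_inv (cH x hx) uniqueDiffWithinAt_univ] at e2
  simp at e2
  rw [e2, eP x hx, (b.hasFDerivAt_of_bilinear (dA' u) (dR w)).fderiv,
    (b.hasFDerivAt_of_bilinear (dA' v) (dR w)).fderiv,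
    (b.hasFDerivAt_of_bilinear (dC' u) (dQ v)).fderiv,
    maurerCartan_inv (cH x hx) uniqueDiffWithinAt_univ]
  have hb1 : ∀ X Y, b (AdL E (H x)⁻¹ X) Y = b X (AdL E (H x) Y) := fun X Y => by
    rw [← hb (H x), AdL_AdL_inv]
  have hb2 : ∀ X Y, b X (AdL E (H x)⁻¹ Y) = b (AdL E (H x) X) Y := fun X Y => by
    rw [← hb (H x), AdL_AdL_inv]
  simp only [← hC, hb1, hb2, map_add, map_neg, add_apply, neg_apply, AdL_AdL_inv,
    ContinuousLinearMap.comp_apply, ContinuousLinearMap.flip_apply,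
    ContinuousLinearMap.precompR_apply, ContinuousLinearMap.precompL_apply,
    ContinuousLinearMap.compL_apply]
  -- The Maurer–Cartan equations put the mixed derivatives on the two sides into the same order, at
  -- the price of cubic terms.
  rw [mcC v w, mcC u w, mcA u v, hs (AdL E (H x) _) (A x v)]
  -- The left side acquires a cubic term from differentiating `Ad(H⁻¹)` along `w`, the right side
  -- one from the Maurer–Cartan equation of `F` in the directions `u, v`. Invariance and
  -- antisymmetry identify them.
  have k : b (A x u) (adL E G (AdL E (H x) (C x w)) (A x v)) =
      -b (adL E G (A x u) (A x v)) (AdL E (H x) (C x w)) := by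
    rw [adL_antisymm, map_neg, adL_antisymm (A x u), map_neg, neg_apply,
      invariant_adL hb (A x v) (A x u), neg_neg]
  simp only [map_add, add_apply, k]
  ring

end PointwiseIdentity

/-! ### Manifold derivatives on the interval, square and cube as logarithmic derivatives. -/

section Bridge

open Filter Topology

variable {E : Type*} [NormedAddCommGroup E] [NormedSpace ℝ E]
  {G : Type*} [TopologicalSpace G] [ChartedSpace E G] [Group G]
  {V : Type*} [NormedAddCommGroup V] [NormedSpace ℝ V]

lemma coe_pr {t : ℝ} (ht : t ∈ Set.Icc (0 : ℝ) 1) : (pr t : ℝ) = t := by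
  simp [pr, Set.projIcc_of_mem _ ht]

@[simp] lemma pr_zero : pr 0 = 0 := Set.projIcc_left _

@[simp] lemma pr_one : pr 1 = 1 := Set.projIcc_right _

/-- `leftLog`, with values in the model space. -/
def leftLogE (E : Type*) [NormedAddCommGroup E] [NormedSpace ℝ E] [ChartedSpace E G]
    (p : unitInterval → G) (t : ℝ) : E := leftLog (E := E) p t

/-- `rightLog`, with values in the model space. -/
def rightLogE (E : Type*) [NormedAddCommGroup E] [NormedSpace ℝ E] [ChartedSpace E G]
    (p : unitInterval → G) (t : ℝ) : E := rightLog (E := E) p t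

lemma mfderivWithin_eq_fderivWithin_chartOne {f : V → G} {s : Set V} {x : V} (hx : f x = 1)
    (hf : MDifferentiableWithinAt 𝓘(ℝ, V) 𝓘(ℝ, E) f s x) :
    @Eq (V →L[ℝ] E) (mfderivWithin 𝓘(ℝ, V) 𝓘(ℝ, E) f s x)
      (fderivWithin ℝ (fun y => chartOne E G (f y)) s x) := by
  have h : @Eq (V →L[ℝ] E) (mfderivWithin 𝓘(ℝ, V) 𝓘(ℝ, E) f s x) _ := if_pos hf
  rw [h]
  have : writtenInExtChartAt 𝓘(ℝ, V) 𝓘(ℝ, E) x f = fun y => chartOne E G (f y) := by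
    ext y
    simp only [writtenInExtChartAt, chartOne, hx, extChartAt_model_space_eq_id]
    rfl
  rw [this, extChartAt_model_space_eq_id]
  simp

variable [LieGroup 𝓘(ℝ, E) ∞ G]

lemma Ad_eq_AdL (g : G) (X : GroupLieAlgebra 𝓘(ℝ, E) G) : @Eq E (Ad g X) (AdL E g X) := by
  have hf : ContMDiffAt 𝓘(ℝ, E) 𝓘(ℝ, E) ∞ (fun x : G => g * x * g⁻¹) 1 :=
    (contMDiffAt_const.mul contMDiffAt_id).mul contMDiffAt_const
  have h : @Eq (E →L[ℝ] E) (mfderiv 𝓘(ℝ, E) 𝓘(ℝ, E) (fun x : G => g * x * g⁻¹) 1) _ :=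
    if_pos (hf.mdifferentiableAt (by simp))
  have : writtenInExtChartAt 𝓘(ℝ, E) 𝓘(ℝ, E) 1 (fun x : G => g * x * g⁻¹) =
      fun a => chartOne E G (g * (chartOne E G).symm a * g⁻¹) := by
    ext y
    simp [writtenInExtChartAt, chartOne]
  refine DFunLike.congr_fun (h.trans ?_) X
  rw [this, AdL]
  simp [chartOne]

lemma leftLog_eq {p : unitInterval → G} (hp : Smooth₁ E p) {t : ℝ}
    (ht : t ∈ Set.Icc (0 : ℝ) 1) :
    leftLogE E p t = maurerCartan E (Set.Icc 0 1) (fun u => p (pr u)) t 1 :=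
  DFunLike.congr_fun (mfderivWithin_eq_fderivWithin_chartOne (E := E)
    (f := fun u : ℝ => (p (pr t))⁻¹ * p (pr u)) (by simp)
    ((contMDiffWithinAt_const.mul (hp t ht)).mdifferentiableWithinAt (by simp))) (1 : ℝ)

/-- The curve `p(u) p(t)⁻¹` is the conjugate of `p(t)⁻¹ p(u)` by the fixed element `p(t)`. -/
lemma rightLog_eq {p : unitInterval → G} (hp : Smooth₁ E p) {t : ℝ}
    (ht : t ∈ Set.Icc (0 : ℝ) 1) :
    rightLogE E p t = AdL E (p (pr t)) (leftLogE E p t) := by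
  rw [leftLog_eq hp ht]
  have h1 : ContMDiffWithinAt 𝓘(ℝ, ℝ) 𝓘(ℝ, E) ∞ (fun u : ℝ => p (pr u) * (p (pr t))⁻¹)
      (Set.Icc 0 1) t := (hp t ht).mul contMDiffWithinAt_const
  refine (DFunLike.congr_fun (mfderivWithin_eq_fderivWithin_chartOne (E := E)
    (f := fun u : ℝ => p (pr u) * (p (pr t))⁻¹)
    (by simp) (h1.mdifferentiableWithinAt (by simp))) (1 : ℝ)).trans ?_
  have h2 := (hasDerivToOne_maurerCartan (hp t ht)).conj (p (pr t))
  rw [(h2.congr' (h := fun u => p (pr u) * (p (pr t))⁻¹)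
    (Eventually.of_forall fun u => by simp) (by simp)).deriv.fderivWithin
      (uniqueDiffOn_Icc zero_lt_one t ht)]
  rfl

omit [LieGroup 𝓘(ℝ, E) ∞ G] in
lemma leftLog_const (g : G) (t : ℝ) : leftLogE E (fun _ => g) t = 0 :=
  DFunLike.congr_fun ((mfderivWithin_eq_fderivWithin_chartOne (E := E)
    (f := fun _ : ℝ => g⁻¹ * g) (s := Set.Icc 0 1) (x := t) (by simp)
    mdifferentiableWithinAt_const).trans (by simp : _ = (0 : ℝ →L[ℝ] E))) (1 : ℝ)

omit [LieGroup 𝓘(ℝ, E) ∞ G] in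
lemma rightLog_const (g : G) (t : ℝ) : rightLogE E (fun _ => g) t = 0 :=
  DFunLike.congr_fun ((mfderivWithin_eq_fderivWithin_chartOne (E := E)
    (f := fun _ : ℝ => g * g⁻¹) (s := Set.Icc 0 1) (x := t) (by simp)
    mdifferentiableWithinAt_const).trans (by simp : _ = (0 : ℝ →L[ℝ] E))) (1 : ℝ)

lemma leftLog_mul {p q : unitInterval → G} (hp : Smooth₁ E p) (hq : Smooth₁ E q) {t : ℝ}
    (ht : t ∈ Set.Icc (0 : ℝ) 1) :
    leftLogE E (fun u => p u * q u) t =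
      AdL E (q (pr t))⁻¹ (leftLogE E p t) + leftLogE E q t := by
  rw [leftLog_eq (p := fun u => p u * q u) (ContMDiffOn.mul hp hq) ht, leftLog_eq hp ht,
    leftLog_eq hq ht, maurerCartan_mul (hp t ht) (hq t ht) (uniqueDiffOn_Icc zero_lt_one t ht)]
  rfl

lemma rightLog_mul {p q : unitInterval → G} (hp : Smooth₁ E p) (hq : Smooth₁ E q) {t : ℝ}
    (ht : t ∈ Set.Icc (0 : ℝ) 1) :
    rightLogE E (fun u => p u * q u) t =
      rightLogE E p t + AdL E (p (pr t)) (rightLogE E q t) := by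
  rw [rightLog_eq (p := fun u => p u * q u) (ContMDiffOn.mul hp hq) ht, rightLog_eq hp ht,
    rightLog_eq hq ht, leftLog_mul hp hq ht, map_add, AdL_mul_apply, AdL_mul_apply, AdL_AdL_inv]

lemma rightLog_inv {p : unitInterval → G} (hp : Smooth₁ E p) {t : ℝ}
    (ht : t ∈ Set.Icc (0 : ℝ) 1) :
    rightLogE E (fun u => (p u)⁻¹) t = -leftLogE E p t := by
  have hp' : Smooth₁ E (fun u => (p u)⁻¹) := ContMDiffOn.inv hp
  rw [rightLog_eq hp' ht, leftLog_eq hp' ht, leftLog_eq hp ht,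
    maurerCartan_inv (hp t ht) (uniqueDiffOn_Icc zero_lt_one t ht)]
  simp

/-- Logarithmic derivatives along a line. -/
lemma leftLog_comp {K : Set V} {F : V → G} (hF : ContMDiffOn 𝓘(ℝ, V) 𝓘(ℝ, E) ∞ F K)
    {ℓ : ℝ → V} {v : V} {t : ℝ} (hℓ : HasDerivAt ℓ v t) (hK : Set.MapsTo ℓ (Set.Icc 0 1) K)
    (cℓ : ContDiff ℝ ∞ ℓ)
    {p : unitInterval → G} (hp : ∀ u ∈ Set.Icc (0 : ℝ) 1, p (pr u) = F (ℓ u))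
    (ht : t ∈ Set.Icc (0 : ℝ) 1) :
    leftLogE E p t = maurerCartan E K F (ℓ t) v ∧ Smooth₁ E p := by
  have hs : Smooth₁ E p :=
    ContMDiffOn.congr (f := fun u : ℝ => F (ℓ u))
      (ContMDiffOn.comp (g := F) hF cℓ.contMDiff.contMDiffOn hK) hp
  refine ⟨?_, hs⟩
  rw [leftLog_eq hs ht, maurerCartan_congr hp ht, maurerCartan_comp (F := F) (hF _ (hK ht))
    hℓ.hasFDerivAt.hasFDerivWithinAt hK (uniqueDiffOn_Icc zero_lt_one t ht),
    ContinuousLinearMap.comp_apply, ContinuousLinearMap.toSpanSingleton_apply, one_smul]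

/-! ### Squares and cubes -/

/-- The unit square. -/
def square : Set (ℝ × ℝ) := Set.Icc 0 1 ×ˢ Set.Icc 0 1

/-- The unit cube. -/
def cube : Set (ℝ × ℝ × ℝ) := Set.Icc 0 1 ×ˢ Set.Icc 0 1 ×ˢ Set.Icc 0 1

lemma uniqueDiffOn_square : UniqueDiffOn ℝ square :=
  (uniqueDiffOn_Icc zero_lt_one).prod (uniqueDiffOn_Icc zero_lt_one)

lemma uniqueDiffOn_cube : UniqueDiffOn ℝ cube :=
  (uniqueDiffOn_Icc zero_lt_one).prod uniqueDiffOn_square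

section slices

variable {f : unitInterval → unitInterval → G}

lemma Smooth₂.leftLog_fst (hf : Smooth₂ E f) {s r : ℝ} (hs : s ∈ Set.Icc (0 : ℝ) 1)
    (hr : r ∈ Set.Icc (0 : ℝ) 1) :
    leftLogE E (fun s' => f s' (pr r)) s =
      maurerCartan E square (fun x => f (pr x.1) (pr x.2)) (s, r) (1, 0) ∧
      Smooth₁ E (fun s' => f s' (pr r)) :=
  leftLog_comp (K := square) (F := fun x => f (pr x.1) (pr x.2)) hf (ℓ := fun u => (u, r))
    ((hasDerivAt_id s).prodMk (hasDerivAt_const s r)) (fun _ hu => ⟨hu, hr⟩)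
    (contDiff_id.prodMk contDiff_const) (fun _ _ => rfl) hs

lemma Smooth₂.leftLog_snd (hf : Smooth₂ E f) {s r : ℝ} (hs : s ∈ Set.Icc (0 : ℝ) 1)
    (hr : r ∈ Set.Icc (0 : ℝ) 1) :
    leftLogE E (fun r' => f (pr s) r') r =
      maurerCartan E square (fun x => f (pr x.1) (pr x.2)) (s, r) (0, 1) ∧
      Smooth₁ E (fun r' => f (pr s) r') :=
  leftLog_comp (K := square) (F := fun x => f (pr x.1) (pr x.2)) hf (ℓ := fun u => (s, u))
    ((hasDerivAt_const r s).prodMk (hasDerivAt_id r)) (fun _ hu => ⟨hs, hu⟩)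
    (contDiff_const.prodMk contDiff_id) (fun _ _ => rfl) hr

variable {D : unitInterval → unitInterval → unitInterval → G}

lemma Smooth₃.leftLog_fst (hD : Smooth₃ E D) {τ s r : ℝ} (hτ : τ ∈ Set.Icc (0 : ℝ) 1)
    (hs : s ∈ Set.Icc (0 : ℝ) 1) (hr : r ∈ Set.Icc (0 : ℝ) 1) :
    leftLogE E (fun τ' => D τ' (pr s) (pr r)) τ =
      maurerCartan E cube (fun x => D (pr x.1) (pr x.2.1) (pr x.2.2)) (τ, s, r) (1, 0, 0) ∧
      Smooth₁ E (fun τ' => D τ' (pr s) (pr r)) :=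
  leftLog_comp (K := cube) (F := fun x => D (pr x.1) (pr x.2.1) (pr x.2.2)) hD
    (ℓ := fun u => (u, s, r))
    ((hasDerivAt_id τ).prodMk (hasDerivAt_const τ (s, r))) (fun _ hu => ⟨hu, hs, hr⟩)
    (contDiff_id.prodMk contDiff_const) (fun _ _ => rfl) hτ

lemma Smooth₃.leftLog_snd (hD : Smooth₃ E D) {τ s r : ℝ} (hτ : τ ∈ Set.Icc (0 : ℝ) 1)
    (hs : s ∈ Set.Icc (0 : ℝ) 1) (hr : r ∈ Set.Icc (0 : ℝ) 1) :
    leftLogE E (fun s' => D (pr τ) s' (pr r)) s =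
      maurerCartan E cube (fun x => D (pr x.1) (pr x.2.1) (pr x.2.2)) (τ, s, r) (0, 1, 0) ∧
      Smooth₁ E (fun s' => D (pr τ) s' (pr r)) :=
  leftLog_comp (K := cube) (F := fun x => D (pr x.1) (pr x.2.1) (pr x.2.2)) hD
    (ℓ := fun u => (τ, u, r))
    ((hasDerivAt_const s τ).prodMk ((hasDerivAt_id s).prodMk (hasDerivAt_const s r)))
    (fun _ hu => ⟨hτ, hu, hr⟩)
    (contDiff_const.prodMk (contDiff_id.prodMk contDiff_const)) (fun _ _ => rfl) hs

lemma Smooth₃.leftLog_thd (hD : Smooth₃ E D) {τ s r : ℝ} (hτ : τ ∈ Set.Icc (0 : ℝ) 1)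
    (hs : s ∈ Set.Icc (0 : ℝ) 1) (hr : r ∈ Set.Icc (0 : ℝ) 1) :
    leftLogE E (fun r' => D (pr τ) (pr s) r') r =
      maurerCartan E cube (fun x => D (pr x.1) (pr x.2.1) (pr x.2.2)) (τ, s, r) (0, 0, 1) ∧
      Smooth₁ E (fun r' => D (pr τ) (pr s) r') :=
  leftLog_comp (K := cube) (F := fun x => D (pr x.1) (pr x.2.1) (pr x.2.2)) hD
    (ℓ := fun u => (τ, s, u))
    ((hasDerivAt_const r τ).prodMk ((hasDerivAt_const r s).prodMk (hasDerivAt_id r)))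
    (fun _ hu => ⟨hτ, hs, hu⟩)
    (contDiff_const.prodMk (contDiff_const.prodMk contDiff_id)) (fun _ _ => rfl) hr

/-- Differentiating in the last variable commutes with passing to logarithmic derivatives. -/
lemma Smooth₃.algDeriv_leftLog (hD : Smooth₃ E D) {τ s r : ℝ} (hτ : τ ∈ Set.Icc (0 : ℝ) 1)
    (hs : s ∈ Set.Icc (0 : ℝ) 1) (hr : r ∈ Set.Icc (0 : ℝ) 1) :
    algDeriv (G := G) (fun r => leftLog (fun s' => D (pr τ) s' (pr r)) s) r =
      fderivWithin ℝ (maurerCartan E cube (fun x => D (pr x.1) (pr x.2.1) (pr x.2.2)))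
        cube (τ, s, r) (0, 0, 1) (0, 1, 0) := by
  set A := maurerCartan E cube (fun x => D (pr x.1) (pr x.2.1) (pr x.2.2)) with hA
  have hd : HasFDerivWithinAt A (fderivWithin ℝ A cube (τ, s, r)) cube (τ, s, r) :=
    (((contDiffOn_maurerCartan hD uniqueDiffOn_cube) (τ, s, r) ⟨hτ, hs, hr⟩).differentiableWithinAt
      (by simp)).hasFDerivWithinAt
  have hl : HasDerivAt (fun u : ℝ => (τ, s, u)) (0, 0, 1) r :=
    (hasDerivAt_const r τ).prodMk ((hasDerivAt_const r s).prodMk (hasDerivAt_id r))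
  have h1 := (HasFDerivWithinAt.comp_hasDerivWithinAt (f := fun u : ℝ => (τ, s, u)) r hd
    (hl.hasDerivWithinAt (s := Set.Icc 0 1))
    (fun _ hu => ⟨hτ, hs, hu⟩)).clm_apply (hasDerivWithinAt_const r _ (0, 1, 0))
  have h2 : derivWithin (fun r => leftLogE E (fun s' => D (pr τ) s' (pr r)) s)
      (Set.Icc 0 1) r = derivWithin (fun r => A (τ, s, r) (0, 1, 0)) (Set.Icc 0 1) r :=
    derivWithin_congr (fun u hu => (hD.leftLog_snd hτ hs hu).1) (hD.leftLog_snd hτ hs hr).1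
  refine h2.trans ((h1.derivWithin (uniqueDiffOn_Icc zero_lt_one r hr)).trans ?_)
  simp

end slices

end Bridge

/-! ### Fubini and the fundamental theorem of calculus on the square and the cube. -/

section Integration

open intervalIntegral

/-- The iterated integral over the unit square. -/
def squareIntegral (u : ℝ × ℝ → ℝ) : ℝ := ∫ x in (0 : ℝ)..1, ∫ y in (0 : ℝ)..1, u (x, y)

/-- The iterated integral over the unit cube. -/
def cubeIntegral (u : ℝ × ℝ × ℝ → ℝ) : ℝ :=
  ∫ x in (0 : ℝ)..1, ∫ y in (0 : ℝ)..1, ∫ z in (0 : ℝ)..1, u (x, y, z)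

lemma squareIntegral_congr {u v : ℝ × ℝ → ℝ}
    (h : ∀ x ∈ Set.Ioo (0 : ℝ) 1, ∀ y ∈ Set.Ioo (0 : ℝ) 1, u (x, y) = v (x, y)) :
    squareIntegral u = squareIntegral v :=
  integral_congr_Ioo_of_le zero_le_one fun x hx =>
    integral_congr_Ioo_of_le zero_le_one fun y hy => h x hx y hy

lemma cubeIntegral_congr {u v : ℝ × ℝ × ℝ → ℝ}
    (h : ∀ x ∈ Set.Ioo (0 : ℝ) 1, ∀ y ∈ Set.Ioo (0 : ℝ) 1, ∀ z ∈ Set.Ioo (0 : ℝ) 1,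
      u (x, y, z) = v (x, y, z)) :
    cubeIntegral u = cubeIntegral v :=
  integral_congr_Ioo_of_le zero_le_one fun x hx =>
    integral_congr_Ioo_of_le zero_le_one fun y hy =>
      integral_congr_Ioo_of_le zero_le_one fun z hz => h x hx y hy z hz

lemma continuous_coe_pr : Continuous fun x : ℝ => (pr x : ℝ) :=
  continuous_subtype_val.comp continuous_projIcc

/-- Clamping the coordinates to `[0,1]` makes the integrand continuous on the whole plane, so that
integrability becomes automatic. Agreement on the open square is enough for the iterated integral.
-/
lemma exists_continuous_square {u : ℝ × ℝ → ℝ} (hu : ContinuousOn u square) :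
    ∃ v : ℝ × ℝ → ℝ, Continuous v ∧ ∀ x ∈ Set.Ioo (0 : ℝ) 1, ∀ y ∈ Set.Ioo (0 : ℝ) 1,
      u (x, y) = v (x, y) := by
  refine ⟨fun x => u (pr x.1, pr x.2), hu.comp_continuous
    ((continuous_coe_pr.comp continuous_fst).prodMk (continuous_coe_pr.comp continuous_snd))
    fun x => ⟨(pr x.1).2, (pr x.2).2⟩, fun x hx y hy => ?_⟩
  simp only [coe_pr (Set.Ioo_subset_Icc_self hx), coe_pr (Set.Ioo_subset_Icc_self hy)]

lemma exists_continuous_cube {u : ℝ × ℝ × ℝ → ℝ} (hu : ContinuousOn u cube) :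
    ∃ v : ℝ × ℝ × ℝ → ℝ, Continuous v ∧ ∀ x ∈ Set.Ioo (0 : ℝ) 1, ∀ y ∈ Set.Ioo (0 : ℝ) 1,
      ∀ z ∈ Set.Ioo (0 : ℝ) 1, u (x, y, z) = v (x, y, z) := by
  refine ⟨fun x => u (pr x.1, pr x.2.1, pr x.2.2), hu.comp_continuous
    ((continuous_coe_pr.comp continuous_fst).prodMk
      ((continuous_coe_pr.comp (continuous_fst.comp continuous_snd)).prodMk
      (continuous_coe_pr.comp (continuous_snd.comp continuous_snd))))
    fun x => ⟨(pr x.1).2, (pr x.2.1).2, (pr x.2.2).2⟩, fun x hx y hy z hz => ?_⟩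
  simp only [coe_pr (Set.Ioo_subset_Icc_self hx), coe_pr (Set.Ioo_subset_Icc_self hy),
    coe_pr (Set.Ioo_subset_Icc_self hz)]

lemma squareIntegral_add {u v : ℝ × ℝ → ℝ} (hu : ContinuousOn u square)
    (hv : ContinuousOn v square) :
    squareIntegral (fun x => u x + v x) = squareIntegral u + squareIntegral v := by
  obtain ⟨u', hu', eu⟩ := exists_continuous_square hu
  obtain ⟨v', hv', ev⟩ := exists_continuous_square hv
  rw [squareIntegral_congr (v := fun x => u' x + v' x)
    (fun x hx y hy => by simp only [eu x hx y hy, ev x hx y hy]),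
    squareIntegral_congr eu, squareIntegral_congr ev]
  simp only [squareIntegral]
  rw [← integral_add (Continuous.intervalIntegrable (by fun_prop) _ _)
    (Continuous.intervalIntegrable (by fun_prop) _ _)]
  refine integral_congr fun x _ => ?_
  exact integral_add (Continuous.intervalIntegrable (by fun_prop) _ _)
    (Continuous.intervalIntegrable (by fun_prop) _ _)

lemma squareIntegral_neg (u : ℝ × ℝ → ℝ) :
    squareIntegral (fun x => -u x) = -squareIntegral u := by
  simp [squareIntegral]

lemma squareIntegral_sub {u v : ℝ × ℝ → ℝ} (hu : ContinuousOn u square)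
    (hv : ContinuousOn v square) :
    squareIntegral (fun x => u x - v x) = squareIntegral u - squareIntegral v := by
  simp only [sub_eq_add_neg]
  rw [squareIntegral_add hu (v := fun x => -v x) hv.neg, squareIntegral_neg]

lemma squareIntegral_swap {u : ℝ × ℝ → ℝ} (hu : ContinuousOn u square) :
    squareIntegral u = squareIntegral (fun x => u x.swap) := by
  obtain ⟨u', hu', eu⟩ := exists_continuous_square hu
  rw [squareIntegral_congr eu, squareIntegral_congr (u := fun x => u x.swap) (v := fun x => u' x.swap)
    fun x hx y hy => eu y hy x hx]
  exact intervalIntegral_intervalIntegral_swap (F := fun x y => u' (x, y))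
    ((Continuous.continuousOn (by simpa [Function.uncurry_def] using hu')).integrableOn_compact
      (isCompact_uIcc.prod isCompact_uIcc) |>.mono_set
      (Set.prod_mono Set.uIoc_subset_uIcc Set.uIoc_subset_uIcc))

lemma cubeIntegral_add {u v : ℝ × ℝ × ℝ → ℝ} (hu : ContinuousOn u cube)
    (hv : ContinuousOn v cube) :
    cubeIntegral (fun x => u x + v x) = cubeIntegral u + cubeIntegral v := by
  obtain ⟨u', hu', eu⟩ := exists_continuous_cube hu
  obtain ⟨v', hv', ev⟩ := exists_continuous_cube hv
  rw [cubeIntegral_congr (v := fun x => u' x + v' x)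
    (fun x hx y hy z hz => by simp only [eu x hx y hy z hz, ev x hx y hy z hz]),
    cubeIntegral_congr eu, cubeIntegral_congr ev]
  simp only [cubeIntegral]
  rw [← integral_add (Continuous.intervalIntegrable (by fun_prop) _ _)
    (Continuous.intervalIntegrable (by fun_prop) _ _)]
  refine integral_congr fun x _ => ?_
  exact squareIntegral_add (u := fun y => u' (x, y)) (v := fun y => v' (x, y))
    (Continuous.continuousOn (by fun_prop)) (Continuous.continuousOn (by fun_prop))

lemma cubeIntegral_sub {u v : ℝ × ℝ × ℝ → ℝ} (hu : ContinuousOn u cube)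
    (hv : ContinuousOn v cube) :
    cubeIntegral (fun x => u x - v x) = cubeIntegral u - cubeIntegral v := by
  simp only [sub_eq_add_neg]
  rw [cubeIntegral_add hu (v := fun x => -v x) hv.neg]
  simp [cubeIntegral]

/-- The cyclic change of the order of integration. -/
lemma cubeIntegral_rotate {u : ℝ × ℝ × ℝ → ℝ} (hu : ContinuousOn u cube) :
    cubeIntegral u = cubeIntegral (fun x => u (x.2.1, x.2.2, x.1)) := by
  obtain ⟨u', hu', eu⟩ := exists_continuous_cube hu
  rw [cubeIntegral_congr eu, cubeIntegral_congr
    (u := fun x => u (x.2.1, x.2.2, x.1)) (v := fun x => u' (x.2.1, x.2.2, x.1))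
    fun x hx y hy z hz => eu y hy z hz x hx]
  have h1 : ∀ x, ∫ y in (0 : ℝ)..1, ∫ z in (0 : ℝ)..1, u' (x, y, z) =
      ∫ z in (0 : ℝ)..1, ∫ y in (0 : ℝ)..1, u' (x, y, z) := fun x =>
    squareIntegral_swap (u := fun y => u' (x, y)) (Continuous.continuousOn (by fun_prop))
  simp only [cubeIntegral, h1]
  exact squareIntegral_swap (u := fun x : ℝ × ℝ => ∫ y in (0 : ℝ)..1, u' (x.1, y, x.2))
    (Continuous.continuousOn (by fun_prop))

/-- Exchanging the two last variables of integration. -/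
lemma cubeIntegral_swap {u : ℝ × ℝ × ℝ → ℝ} (hu : ContinuousOn u cube) :
    cubeIntegral u = cubeIntegral (fun x => u (x.1, x.2.2, x.2.1)) := by
  obtain ⟨u', hu', eu⟩ := exists_continuous_cube hu
  rw [cubeIntegral_congr eu, cubeIntegral_congr
    (u := fun x => u (x.1, x.2.2, x.2.1)) (v := fun x => u' (x.1, x.2.2, x.2.1))
    fun x hx y hy z hz => eu x hx z hz y hy]
  refine integral_congr fun x _ => ?_
  exact squareIntegral_swap (u := fun y => u' (x, y)) (Continuous.continuousOn (by fun_prop))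

section

variable {g : ℝ × ℝ × ℝ → ℝ}

lemma continuousOn_fderivWithin_cube {F : Type*} [NormedAddCommGroup F] [NormedSpace ℝ F]
    {g : ℝ × ℝ × ℝ → F} (hg : ContDiffOn ℝ ∞ g cube) (v : ℝ × ℝ × ℝ) :
    ContinuousOn (fun x => fderivWithin ℝ g cube x v) cube :=
  (hg.continuousOn_fderivWithin uniqueDiffOn_cube (by simp)).clm_apply continuousOn_const

/-- The fundamental theorem of calculus on a segment in the cube. -/
lemma integral_fderivWithin_line (hg : ContDiffOn ℝ ∞ g cube) {ℓ : ℝ → ℝ × ℝ × ℝ}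
    {v : ℝ × ℝ × ℝ} (hℓ : ∀ t, HasDerivAt ℓ v t) (hc : Set.MapsTo ℓ (Set.Icc 0 1) cube) :
    ∫ t in (0 : ℝ)..1, fderivWithin ℝ g cube (ℓ t) v = g (ℓ 1) - g (ℓ 0) := by
  have cℓ : Continuous ℓ := continuous_iff_continuousAt.2 fun t => (hℓ t).continuousAt
  refine integral_eq_sub_of_hasDerivAt_of_le (f := fun t => g (ℓ t)) zero_le_one
    (hg.continuousOn.comp cℓ.continuousOn hc) (fun t ht => ?_)
    (ContinuousOn.intervalIntegrable ?_)
  · have h1 := ((hg (ℓ t) (hc (Set.Ioo_subset_Icc_self ht))).differentiableWithinAt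
      (by simp)).hasFDerivWithinAt
    exact (h1.comp_hasDerivWithinAt t (hℓ t).hasDerivWithinAt hc).hasDerivAt
      (Icc_mem_nhds ht.1 ht.2)
  · rw [Set.uIcc_of_le zero_le_one]
    exact (continuousOn_fderivWithin_cube hg v).comp cℓ.continuousOn hc

lemma cubeIntegral_fderivWithin_thd (hg : ContDiffOn ℝ ∞ g cube) :
    cubeIntegral (fun x => fderivWithin ℝ g cube x (0, 0, 1)) =
      squareIntegral (fun y => g (y.1, y.2, 1) - g (y.1, y.2, 0)) := by
  refine integral_congr_Ioo_of_le zero_le_one fun x hx =>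
    integral_congr_Ioo_of_le zero_le_one fun y hy => ?_
  exact integral_fderivWithin_line hg (ℓ := fun t => (x, y, t))
    (fun t => (hasDerivAt_const t x).prodMk ((hasDerivAt_const t y).prodMk (hasDerivAt_id t)))
    (fun t ht => ⟨Set.Ioo_subset_Icc_self hx, Set.Ioo_subset_Icc_self hy, ht⟩)

/-- The face integral is arranged with the loop variable outermost, the order used in `pairing`. -/
lemma cubeIntegral_fderivWithin_snd (hg : ContDiffOn ℝ ∞ g cube) :
    cubeIntegral (fun x => fderivWithin ℝ g cube x (0, 1, 0)) =
      squareIntegral (fun y => g (y.2, 1, y.1) - g (y.2, 0, y.1)) := by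
  rw [cubeIntegral_rotate (continuousOn_fderivWithin_cube hg _)]
  refine integral_congr_Ioo_of_le zero_le_one fun x hx =>
    integral_congr_Ioo_of_le zero_le_one fun y hy => ?_
  exact integral_fderivWithin_line hg (ℓ := fun t => (y, t, x))
    (fun t => (hasDerivAt_const t y).prodMk ((hasDerivAt_id t).prodMk (hasDerivAt_const t x)))
    (fun t ht => ⟨Set.Ioo_subset_Icc_self hy, ht, Set.Ioo_subset_Icc_self hx⟩)

lemma cubeIntegral_fderivWithin_fst (hg : ContDiffOn ℝ ∞ g cube) :
    cubeIntegral (fun x => fderivWithin ℝ g cube x (1, 0, 0)) =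
      squareIntegral (fun y => g (1, y.2, y.1) - g (0, y.2, y.1)) := by
  have hc := continuousOn_fderivWithin_cube hg (1, 0, 0)
  rw [cubeIntegral_rotate hc, cubeIntegral_swap (u := fun x => fderivWithin ℝ g cube
    (x.2.1, x.2.2, x.1) (1, 0, 0)) (hc.comp
    (f := fun x : ℝ × ℝ × ℝ => (x.2.1, x.2.2, x.1)) (Continuous.continuousOn (by fun_prop))
    (fun x hx => ⟨hx.2.1, hx.2.2, hx.1⟩))]
  refine integral_congr_Ioo_of_le zero_le_one fun x hx =>
    integral_congr_Ioo_of_le zero_le_one fun y hy => ?_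
  exact integral_fderivWithin_line hg (ℓ := fun t => (t, y, x))
    (fun t => (hasDerivAt_id t).prodMk ((hasDerivAt_const t y).prodMk (hasDerivAt_const t x)))
    (fun t ht => ⟨ht, Set.Ioo_subset_Icc_self hy, Set.Ioo_subset_Icc_self hx⟩)

end

end Integration

/-! ### The group cocycle and the multiplicative behaviour of the Kac–Moody integral. -/

section Formulas

open Filter Topology

variable {E : Type*} [NormedAddCommGroup E] [NormedSpace ℝ E]
  {G : Type*} [TopologicalSpace G] [ChartedSpace E G] [Group G]

/-- The double integral in the exponent of the group cocycle. -/
def pairing (b : E →L[ℝ] E →L[ℝ] ℝ) (p q : unitInterval → unitInterval → G) : ℝ :=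
  squareIntegral fun y => b (leftLogE E (fun s' => p s' (pr y.1)) y.2)
    (rightLogE E (fun r' => q (pr y.2) r') y.1)

/-- The integral of the Kac-Moody form over a cube, without the normalisation. -/
def kacMoodyIntegral (b : E →L[ℝ] E →L[ℝ] ℝ) (D : unitInterval → unitInterval → unitInterval → G) :
    ℝ :=
  cubeIntegral fun x =>
    b (maurerCartan E cube (fun x => D (pr x.1) (pr x.2.1) (pr x.2.2)) x (1, 0, 0))
      (fderivWithin ℝ (maurerCartan E cube (fun x => D (pr x.1) (pr x.2.1) (pr x.2.2))) cube x
        (0, 0, 1) (0, 1, 0))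

lemma pairing_const_left (b : E →L[ℝ] E →L[ℝ] ℝ) (p : unitInterval → G)
    (q : unitInterval → unitInterval → G) : pairing b (fun _ => p) q = 0 := by
  simp [pairing, leftLog_const, squareIntegral]

lemma pairing_const_right (b : E →L[ℝ] E →L[ℝ] ℝ) (p : unitInterval → unitInterval → G)
    (q : unitInterval → G) : pairing b p (fun s _ => q s) = 0 := by
  simp [pairing, rightLog_const, squareIntegral]

/-- An invariant bilinear form on the Lie algebra as a continuous bilinear form on the model
space. -/
def formCLM [FiniteDimensional ℝ E] (B : LinearMap.BilinForm ℝ (GroupLieAlgebra 𝓘(ℝ, E) G)) :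
    E →L[ℝ] E →L[ℝ] ℝ :=
  LinearMap.toContinuousBilinearMap (𝕜 := ℝ) (E := E) (F := E) (G := ℝ) B

variable [LieGroup 𝓘(ℝ, E) ∞ G]

lemma formCLM_invariant [FiniteDimensional ℝ E]
    {B : LinearMap.BilinForm ℝ (GroupLieAlgebra 𝓘(ℝ, E) G)} (hB : AdInvariant B)
    (g : G) (X Y : E) : formCLM B (AdL E g X) (AdL E g Y) = formCLM B X Y := by
  have h := hB g X Y
  have h1 : Ad (E := E) g X = AdL E g X := Ad_eq_AdL g X
  have h2 : Ad (E := E) g Y = AdL E g Y := Ad_eq_AdL g Y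
  rw [h1, h2] at h
  exact h

lemma discIntegral_eq [FiniteDimensional ℝ E]
    (B : LinearMap.BilinForm ℝ (GroupLieAlgebra 𝓘(ℝ, E) G))
    {D : unitInterval → unitInterval → unitInterval → G} (hD : Smooth₃ E D) :
    discIntegral B D = 1 / (2 * Real.pi) * kacMoodyIntegral (formCLM B) D := by
  simp only [discIntegral, omega, kacMoodyIntegral, cubeIntegral]
  rw [← intervalIntegral.integral_const_mul]
  refine intervalIntegral.integral_congr_Ioo_of_le zero_le_one fun τ hτ => ?_
  rw [← intervalIntegral.integral_const_mul]
  refine intervalIntegral.integral_congr_Ioo_of_le zero_le_one fun s hs => ?_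
  refine congrArg _ ?_
  refine intervalIntegral.integral_congr_Ioo_of_le zero_le_one fun r hr => ?_
  have iτ := Set.Ioo_subset_Icc_self hτ
  have is := Set.Ioo_subset_Icc_self hs
  have ir := Set.Ioo_subset_Icc_self hr
  have h1 := (hD.leftLog_fst iτ is ir).1
  have h2 := hD.algDeriv_leftLog iτ is ir
  change formCLM B (leftLogE E (fun τ' => D τ' (pr s) (pr r)) τ)
    (algDeriv (G := G) (fun r => leftLog (fun s' => D (pr τ) s' (pr r)) s) r) = _
  rw [h1]
  exact congrArg _ h2

section pairing

variable (b : E →L[ℝ] E →L[ℝ] ℝ) {p q k : unitInterval → unitInterval → G}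

lemma continuousOn_leftLog_fst (hp : Smooth₂ E p) :
    ContinuousOn (fun y : ℝ × ℝ => leftLogE E (fun s' => p s' (pr y.1)) y.2) square := by
  have h1 : ContinuousOn (fun y : ℝ × ℝ => maurerCartan E square (fun x => p (pr x.1) (pr x.2))
      (y.2, y.1) (1, 0)) square :=
    (((contDiffOn_maurerCartan hp uniqueDiffOn_square).continuousOn).comp
      (f := fun y : ℝ × ℝ => (y.2, y.1)) (Continuous.continuousOn (by fun_prop))
      (fun y hy => ⟨hy.2, hy.1⟩)).clm_apply continuousOn_const
  exact h1.congr fun y hy => (hp.leftLog_fst hy.2 hy.1).1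

lemma Smooth₂.rightLog_snd (hq : Smooth₂ E q) {s r : ℝ} (hs : s ∈ Set.Icc (0 : ℝ) 1)
    (hr : r ∈ Set.Icc (0 : ℝ) 1) :
    rightLogE E (fun r' => q (pr s) r') r = AdL E (q (pr s) (pr r))
      (maurerCartan E square (fun x => q (pr x.1) (pr x.2)) (s, r) (0, 1)) := by
  rw [rightLog_eq (hq.leftLog_snd hs hr).2 hr, (hq.leftLog_snd hs hr).1]

lemma continuousOn_rightLog_snd (hq : Smooth₂ E q) :
    ContinuousOn (fun y : ℝ × ℝ => rightLogE E (fun r' => q (pr y.2) r') y.1) square := by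
  have h0 : ContinuousOn (fun y : ℝ × ℝ => (y.2, y.1)) square :=
    Continuous.continuousOn (by fun_prop)
  have h1 : ContinuousOn (fun y : ℝ × ℝ => AdL E (q (pr y.2) (pr y.1))
      (maurerCartan E square (fun x => q (pr x.1) (pr x.2)) (y.2, y.1) (0, 1))) square :=
    ((contDiffOn_AdL hq).continuousOn.comp h0 (fun y hy => ⟨hy.2, hy.1⟩)).clm_apply
    ((((contDiffOn_maurerCartan hq uniqueDiffOn_square).continuousOn).comp h0
      (fun y hy => ⟨hy.2, hy.1⟩)).clm_apply continuousOn_const)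
  exact h1.congr fun y hy => hq.rightLog_snd hy.2 hy.1

lemma continuousOn_pairing (hp : Smooth₂ E p) (hq : Smooth₂ E q) :
    ContinuousOn (fun y : ℝ × ℝ => b (leftLogE E (fun s' => p s' (pr y.1)) y.2)
      (rightLogE E (fun r' => q (pr y.2) r') y.1)) square :=
  ((continuousOn_const (c := b)).clm_apply (continuousOn_leftLog_fst hp)).clm_apply
    (continuousOn_rightLog_snd hq)

/-- The cocycle identity. -/
lemma pairing_cocycle (hb : ∀ (g : G) X Y, b (AdL E g X) (AdL E g Y) = b X Y)
    (hp : Smooth₂ E p) (hq : Smooth₂ E q) (hk : Smooth₂ E k) :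
    pairing b p q + pairing b (p * q) k = pairing b q k + pairing b p (q * k) := by
  have hpq : Smooth₂ E (p * q) := ContMDiffOn.mul hp hq
  have hqk : Smooth₂ E (q * k) := ContMDiffOn.mul hq hk
  simp only [pairing]
  rw [← squareIntegral_add (continuousOn_pairing b hp hq) (continuousOn_pairing b hpq hk),
    ← squareIntegral_add (continuousOn_pairing b hq hk) (continuousOn_pairing b hp hqk)]
  refine squareIntegral_congr fun r hr s hs => ?_
  replace hr := Set.Ioo_subset_Icc_self hr
  replace hs := Set.Ioo_subset_Icc_self hs
  have h1 := leftLog_mul (hp.leftLog_fst hs hr).2 (hq.leftLog_fst hs hr).2 hs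
  have h2 := rightLog_mul (hq.leftLog_snd hs hr).2 (hk.leftLog_snd hs hr).2 hr
  simp only [Pi.mul_apply, h1, h2, map_add, add_apply]
  -- The twist by `q⁻¹` in the left derivative of `pq` moves, by invariance, onto the right
  -- derivative of `k`, where it becomes the twist by `q` occurring for `qk`.
  rw [← hb (q (pr s) (pr r)) (AdL E (q (pr s) (pr r))⁻¹ _), AdL_AdL_inv]
  ring

end pairing

section kacMoody

variable {b : E →L[ℝ] E →L[ℝ] ℝ} {D₁ D₂ : unitInterval → unitInterval → unitInterval → G}

lemma Smooth₃.rightLog_thd {D : unitInterval → unitInterval → unitInterval → G}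
    (hD : Smooth₃ E D) {τ s r : ℝ} (hτ : τ ∈ Set.Icc (0 : ℝ) 1)
    (hs : s ∈ Set.Icc (0 : ℝ) 1) (hr : r ∈ Set.Icc (0 : ℝ) 1) :
    rightLogE E (fun r' => D (pr τ) (pr s) r') r = AdL E (D (pr τ) (pr s) (pr r))
      (maurerCartan E cube (fun x => D (pr x.1) (pr x.2.1) (pr x.2.2)) (τ, s, r) (0, 0, 1)) := by
  rw [rightLog_eq (hD.leftLog_thd hτ hs hr).2 hr, (hD.leftLog_thd hτ hs hr).1]

lemma interior_cube_nhds {x : ℝ × ℝ × ℝ}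
    (hx : x ∈ Set.Ioo (0 : ℝ) 1 ×ˢ Set.Ioo (0 : ℝ) 1 ×ˢ Set.Ioo (0 : ℝ) 1) : cube ∈ 𝓝 x :=
  prod_mem_nhds (Icc_mem_nhds hx.1.1 hx.1.2)
    (prod_mem_nhds (Icc_mem_nhds hx.2.1.1 hx.2.1.2) (Icc_mem_nhds hx.2.2.1 hx.2.2.2))

omit [LieGroup 𝓘(ℝ, E) ∞ G] in
lemma maurerCartan_cube_eventuallyEq {F : ℝ × ℝ × ℝ → G} {x : ℝ × ℝ × ℝ}
    (hx : x ∈ Set.Ioo (0 : ℝ) 1 ×ˢ Set.Ioo (0 : ℝ) 1 ×ˢ Set.Ioo (0 : ℝ) 1) :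
    maurerCartan E cube F =ᶠ[𝓝 x] maurerCartan E Set.univ F := by
  filter_upwards [(isOpen_Ioo.prod (isOpen_Ioo.prod isOpen_Ioo)).mem_nhds hx] with y hy
  refine maurerCartan_congr_set ?_
  filter_upwards [interior_cube_nhds hy] with z hz
  exact propext ⟨fun _ => trivial, fun _ => hz⟩

/-- The behaviour of the integral of the Kac-Moody form under pointwise products: a multiplicative
cocycle up to the boundary integrals of the `pairing`. -/
lemma kacMoodyIntegral_mul (hs : ∀ X Y, b X Y = b Y X)
    (hb : ∀ (g : G) X Y, b (AdL E g X) (AdL E g Y) = b X Y)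
    (h₁ : Smooth₃ E D₁) (h₂ : Smooth₃ E D₂)
    (hz : ∀ τ s, D₂ τ s 0 = D₂ 0 s 0) (ho : ∀ τ s, D₂ τ s 1 = D₂ 0 s 1) :
    kacMoodyIntegral b (D₁ * D₂) = kacMoodyIntegral b D₁ + kacMoodyIntegral b D₂ +
      (pairing b (fun τ => D₁ τ 1) (fun τ => D₂ τ 1) -
        pairing b (fun τ => D₁ τ 0) (fun τ => D₂ τ 0)) -
      (pairing b (D₁ 1) (D₂ 1) - pairing b (D₁ 0) (D₂ 0)) := by
  have h₁₂ : Smooth₃ E (D₁ * D₂) := ContMDiffOn.mul h₁ h₂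
  set F : ℝ × ℝ × ℝ → G := fun x => D₁ (pr x.1) (pr x.2.1) (pr x.2.2) with hF
  set H : ℝ × ℝ × ℝ → G := fun x => D₂ (pr x.1) (pr x.2.1) (pr x.2.2) with hH
  set A := maurerCartan E cube F with hA
  set C := maurerCartan E cube H with hC
  have sA : ContDiffOn ℝ ∞ A cube := contDiffOn_maurerCartan h₁ uniqueDiffOn_cube
  have sC : ContDiffOn ℝ ∞ C cube := contDiffOn_maurerCartan h₂ uniqueDiffOn_cube
  have sA' : ∀ v, ContDiffOn ℝ ∞ (fun x => A x v) cube := fun v => sA.clm_apply contDiffOn_const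
  have sC' : ∀ v, ContDiffOn ℝ ∞ (fun x => C x v) cube := fun v => sC.clm_apply contDiffOn_const
  have sR : ∀ v, ContDiffOn ℝ ∞ (fun x => AdL E (H x) (C x v)) cube := fun v =>
    (contDiffOn_AdL h₂).clm_apply (sC' v)
  have sQ : ∀ v, ContDiffOn ℝ ∞ (fun x => AdL E (H x)⁻¹ (A x v)) cube := fun v =>
    (contDiffOn_AdL (ContMDiffOn.inv h₂)).clm_apply (sA' v)
  have sb : ∀ {X Y : ℝ × ℝ × ℝ → E}, ContDiffOn ℝ ∞ X cube → ContDiffOn ℝ ∞ Y cube →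
      ContDiffOn ℝ ∞ (fun x => b (X x) (Y x)) cube := fun hX hY =>
    ((contDiffOn_const (c := b)).clm_apply hX).clm_apply hY
  have cI : ∀ {L : ℝ × ℝ × ℝ → ℝ × ℝ × ℝ →L[ℝ] E}, ContDiffOn ℝ ∞ L cube →
      ContinuousOn (fun x => b (L x (1, 0, 0)) (fderivWithin ℝ L cube x (0, 0, 1) (0, 1, 0))) cube :=
    fun hL => ((continuousOn_const (c := b)).clm_apply
      (hL.continuousOn.clm_apply continuousOn_const)).clm_apply
      ((continuousOn_fderivWithin_cube hL _).clm_apply continuousOn_const)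
  -- The potentials of the pointwise identity. The index is the coordinate (`τ`, `s`, `r` in this
  -- order) along which each is differentiated, hence the pair of faces on which it is evaluated.
  set g₂ : ℝ × ℝ × ℝ → ℝ := fun x => b (A x (1, 0, 0)) (AdL E (H x) (C x (0, 0, 1))) with hg₂
  set g₁ : ℝ × ℝ × ℝ → ℝ := fun x => b (A x (0, 1, 0)) (AdL E (H x) (C x (0, 0, 1))) with hg₁
  set g₃ : ℝ × ℝ × ℝ → ℝ := fun x => b (C x (1, 0, 0)) (AdL E (H x)⁻¹ (A x (0, 1, 0))) with hg₃
  have sg₂ : ContDiffOn ℝ ∞ g₂ cube := sb (sA' _) (sR _)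
  have sg₁ : ContDiffOn ℝ ∞ g₁ cube := sb (sA' _) (sR _)
  have sg₃ : ContDiffOn ℝ ∞ g₃ cube := sb (sC' _) (sQ _)
  have key : kacMoodyIntegral b (D₁ * D₂) = cubeIntegral (fun x =>
      b (A x (1, 0, 0)) (fderivWithin ℝ A cube x (0, 0, 1) (0, 1, 0)) +
      b (C x (1, 0, 0)) (fderivWithin ℝ C cube x (0, 0, 1) (0, 1, 0)) +
      fderivWithin ℝ g₂ cube x (0, 1, 0) - fderivWithin ℝ g₁ cube x (1, 0, 0) +
      fderivWithin ℝ g₃ cube x (0, 0, 1)) := by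
    refine cubeIntegral_congr fun τ hτ s hs' r hr => ?_
    have hx : (τ, s, r) ∈ Set.Ioo (0 : ℝ) 1 ×ˢ Set.Ioo (0 : ℝ) 1 ×ˢ Set.Ioo (0 : ℝ) 1 :=
      ⟨hτ, hs', hr⟩
    have hn := interior_cube_nhds hx
    have hsub : Set.Ioo (0 : ℝ) 1 ×ˢ Set.Ioo (0 : ℝ) 1 ×ˢ Set.Ioo (0 : ℝ) 1 ⊆ cube :=
      Set.prod_mono Set.Ioo_subset_Icc_self
        (Set.prod_mono Set.Ioo_subset_Icc_self Set.Ioo_subset_Icc_self)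
    have eA : A =ᶠ[𝓝 (τ, s, r)] maurerCartan E Set.univ F := maurerCartan_cube_eventuallyEq hx
    have eC : C =ᶠ[𝓝 (τ, s, r)] maurerCartan E Set.univ H := maurerCartan_cube_eventuallyEq hx
    have eP : maurerCartan E cube (fun x => F x * H x) =ᶠ[𝓝 (τ, s, r)]
      maurerCartan E Set.univ (fun x => F x * H x) := maurerCartan_cube_eventuallyEq hx
    have e₂ : g₂ =ᶠ[𝓝 (τ, s, r)] fun x => b (maurerCartan E Set.univ F x (1, 0, 0))
        (AdL E (H x) (maurerCartan E Set.univ H x (0, 0, 1))) := by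
      filter_upwards [eA, eC] with y h1 h2
      simp only [hg₂, h1, h2]
    have e₁ : g₁ =ᶠ[𝓝 (τ, s, r)] fun x => b (maurerCartan E Set.univ F x (0, 1, 0))
        (AdL E (H x) (maurerCartan E Set.univ H x (0, 0, 1))) := by
      filter_upwards [eA, eC] with y h1 h2
      simp only [hg₁, h1, h2]
    have e₃ : g₃ =ᶠ[𝓝 (τ, s, r)] fun x => b (maurerCartan E Set.univ H x (1, 0, 0))
        (AdL E (H x)⁻¹ (maurerCartan E Set.univ F x (0, 1, 0))) := by
      filter_upwards [eA, eC] with y h1 h2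
      simp only [hg₃, h1, h2]
    change b (maurerCartan E cube (fun x => F x * H x) _ _)
      (fderivWithin ℝ (maurerCartan E cube (fun x => F x * H x)) _ _ _ _) = _
    simp only [fderivWithin_of_mem_nhds hn]
    rw [eP.fderiv_eq, eA.fderiv_eq, eC.fderiv_eq, e₁.fderiv_eq, e₂.fderiv_eq, e₃.fderiv_eq,
      eP.eq_of_nhds, eA.eq_of_nhds, eC.eq_of_nhds]
    exact kacMoody_mul_pointwise hs hb (isOpen_Ioo.prod (isOpen_Ioo.prod isOpen_Ioo))
      (ContMDiffOn.mono h₁ hsub) (ContMDiffOn.mono h₂ hsub) hx (1, 0, 0) (0, 1, 0) (0, 0, 1)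
  have c₁ := continuousOn_fderivWithin_cube sg₁ (1, 0, 0)
  have c₂ := continuousOn_fderivWithin_cube sg₂ (0, 1, 0)
  have c₃ := continuousOn_fderivWithin_cube sg₃ (0, 0, 1)
  have m0 : (0 : ℝ) ∈ Set.Icc (0 : ℝ) 1 := ⟨le_rfl, zero_le_one⟩
  have m1 : (1 : ℝ) ∈ Set.Icc (0 : ℝ) 1 := ⟨zero_le_one, le_rfl⟩
  -- On the faces `r = 0` and `r = 1` the map `D₂` does not vary with `τ`, so the factor `C x (1, 0,
  -- 0)` of `g₃` vanishes there.
  have t₃ : cubeIntegral (fun x => fderivWithin ℝ g₃ cube x (0, 0, 1)) = 0 := by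
    rw [cubeIntegral_fderivWithin_thd sg₃,
      squareIntegral_congr (v := fun _ => 0) (fun τ hτ s hs' => ?_)]
    · simp [squareIntegral]
    · replace hτ := Set.Ioo_subset_Icc_self hτ
      replace hs' := Set.Ioo_subset_Icc_self hs'
      have hC0 : ∀ r ∈ Set.Icc (0 : ℝ) 1, (∀ τ s, D₂ τ s (pr r) = D₂ 0 s (pr r)) →
          C (τ, s, r) (1, 0, 0) = 0 := fun r hr h => by
        rw [← (h₂.leftLog_fst hτ hs' hr).1]
        simp only [h _ (pr s)]
        exact leftLog_const _ _
      simp only [hg₃]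
      rw [hC0 1 m1 (by simpa using ho), hC0 0 m0 (by simpa using hz)]
      simp
  have t₂ : cubeIntegral (fun x => fderivWithin ℝ g₂ cube x (0, 1, 0)) =
      pairing b (fun τ => D₁ τ 1) (fun τ => D₂ τ 1) -
        pairing b (fun τ => D₁ τ 0) (fun τ => D₂ τ 0) := by
    have e : ∀ s ∈ Set.Icc (0 : ℝ) 1, squareIntegral (fun y => g₂ (y.2, s, y.1)) =
        pairing b (fun τ => D₁ τ (pr s)) (fun τ => D₂ τ (pr s)) := fun s hs' =>
      squareIntegral_congr fun r hr τ hτ => by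
        replace hr := Set.Ioo_subset_Icc_self hr
        replace hτ := Set.Ioo_subset_Icc_self hτ
        rw [(h₁.leftLog_fst hτ hs' hr).1, h₂.rightLog_thd hτ hs' hr]
    have cc : ∀ s ∈ Set.Icc (0 : ℝ) 1, ContinuousOn (fun y : ℝ × ℝ => g₂ (y.2, s, y.1)) square :=
      fun s hs' => sg₂.continuousOn.comp (f := fun y : ℝ × ℝ => (y.2, s, y.1))
        (Continuous.continuousOn (by fun_prop)) (fun y hy => ⟨hy.2, hs', hy.1⟩)
    rw [cubeIntegral_fderivWithin_snd sg₂, squareIntegral_sub (cc 1 m1) (cc 0 m0), e 1 m1, e 0 m0,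
      pr_one, pr_zero]
  have t₁ : cubeIntegral (fun x => fderivWithin ℝ g₁ cube x (1, 0, 0)) =
      pairing b (D₁ 1) (D₂ 1) - pairing b (D₁ 0) (D₂ 0) := by
    have e : ∀ τ ∈ Set.Icc (0 : ℝ) 1, squareIntegral (fun y => g₁ (τ, y.2, y.1)) =
        pairing b (D₁ (pr τ)) (D₂ (pr τ)) := fun τ hτ =>
      squareIntegral_congr fun r hr s hs' => by
        replace hr := Set.Ioo_subset_Icc_self hr
        replace hs' := Set.Ioo_subset_Icc_self hs'
        rw [(h₁.leftLog_snd hτ hs' hr).1, h₂.rightLog_thd hτ hs' hr]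
    have cc : ∀ τ ∈ Set.Icc (0 : ℝ) 1, ContinuousOn (fun y : ℝ × ℝ => g₁ (τ, y.2, y.1)) square :=
      fun τ hτ => sg₁.continuousOn.comp (f := fun y : ℝ × ℝ => (τ, y.2, y.1))
        (Continuous.continuousOn (by fun_prop)) (fun y hy => ⟨hτ, hy.2, hy.1⟩)
    rw [cubeIntegral_fderivWithin_fst sg₁, squareIntegral_sub (cc 1 m1) (cc 0 m0), e 1 m1, e 0 m0,
      pr_one, pr_zero]
  have k₁ := cubeIntegral_add (cI sA) (cI sC)
  have k₂ := cubeIntegral_add ((cI sA).add (cI sC)) c₂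
  have k₃ := cubeIntegral_sub (((cI sA).add (cI sC)).add c₂) c₁
  have k₄ := cubeIntegral_add ((((cI sA).add (cI sC)).add c₂).sub c₁) c₃
  simp only [Pi.add_def, Pi.sub_def] at k₂ k₃ k₄
  rw [key, k₄, k₃, k₂, k₁, t₁, t₂, t₃, add_zero]
  rfl

end kacMoody

end Formulas

/-! ### The extension of all smooth squares, and discs inside it. -/

section SquareExtension

variable {E : Type*} [NormedAddCommGroup E] [NormedSpace ℝ E]
  {G : Type*} [TopologicalSpace G] [ChartedSpace E G] [Group G] [LieGroup 𝓘(ℝ, E) ∞ G]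

variable (E G) in
/-- The group of all smooth maps from the square to `G`, without boundary conditions. -/
def smoothSquare : Subgroup (unitInterval → unitInterval → G) where
  carrier := {f | Smooth₂ E f}
  mul_mem' hf hh := ContMDiffOn.mul hf hh
  one_mem' := contMDiffOn_const
  inv_mem' hf := ContMDiffOn.inv hf

/-- The central extension of the group of smooth maps from the square to `G` by the cocycle of
`pairing`. -/
@[ext]
structure SquareExt (b : E →L[ℝ] E →L[ℝ] ℝ)
    (hb : ∀ (g : G) X Y, b (AdL E g X) (AdL E g Y) = b X Y) where
  /-- the component in the group of maps -/
  path : smoothSquare E G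
  /-- the component in `U(1)` -/
  phase : Circle

namespace SquareExt

variable {b : E →L[ℝ] E →L[ℝ] ℝ} {hb : ∀ (g : G) X Y, b (AdL E g X) (AdL E g Y) = b X Y}

/-- The element `(p, exp(iθ))`. -/
def lift (b : E →L[ℝ] E →L[ℝ] ℝ) (hb : ∀ (g : G) X Y, b (AdL E g X) (AdL E g Y) = b X Y)
    (p : smoothSquare E G) (θ : ℝ) : SquareExt b hb := ⟨p, Circle.exp θ⟩

lemma exists_lift (x : SquareExt b hb) : ∃ p θ, x = lift b hb p θ :=
  ⟨x.path, Complex.arg x.phase, SquareExt.ext rfl (Circle.exp_arg x.phase).symm⟩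

instance : Mul (SquareExt b hb) :=
  ⟨fun x y => ⟨x.path * y.path, x.phase * y.phase *
    Circle.exp (-(1 / (2 * Real.pi)) * pairing b x.path.1 y.path.1)⟩⟩

instance : One (SquareExt b hb) := ⟨⟨1, 1⟩⟩

instance : Inv (SquareExt b hb) :=
  ⟨fun x => ⟨x.path⁻¹, x.phase⁻¹ *
    Circle.exp (1 / (2 * Real.pi) * pairing b (x.path⁻¹).1 x.path.1)⟩⟩

lemma lift_mul (p q : smoothSquare E G) (θ η : ℝ) :
    lift b hb p θ * lift b hb q η =
      lift b hb (p * q) (θ + η - 1 / (2 * Real.pi) * pairing b p.1 q.1) := by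
  refine SquareExt.ext rfl ?_
  change Circle.exp θ * Circle.exp η * Circle.exp (-(1 / (2 * Real.pi)) * pairing b p.1 q.1) =
    Circle.exp _
  rw [← Circle.exp_add, ← Circle.exp_add]
  congr 1
  ring

lemma lift_one : lift b hb 1 0 = 1 :=
  SquareExt.ext rfl Circle.exp_zero

lemma lift_inv' (p : smoothSquare E G) (θ : ℝ) :
    (lift b hb p θ)⁻¹ =
      lift b hb p⁻¹ (-θ + 1 / (2 * Real.pi) * pairing b (p⁻¹).1 p.1) := by
  refine SquareExt.ext rfl ?_
  change (Circle.exp θ)⁻¹ * Circle.exp (1 / (2 * Real.pi) * pairing b (p⁻¹).1 p.1) = Circle.exp _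
  rw [← Circle.exp_neg, ← Circle.exp_add]

omit [LieGroup 𝓘(ℝ, E) ∞ G] in
lemma pairing_one_left (q : unitInterval → unitInterval → G) : pairing b 1 q = 0 :=
  pairing_const_left b 1 q

omit [LieGroup 𝓘(ℝ, E) ∞ G] in
lemma pairing_one_right (q : unitInterval → unitInterval → G) : pairing b q 1 = 0 :=
  pairing_const_right b q 1

instance : Group (SquareExt b hb) := by
  refine Group.ofLeftAxioms (fun x y z => ?_) (fun x => ?_) (fun x => ?_)
  · obtain ⟨p, θ, rfl⟩ := x.exists_lift
    obtain ⟨q, η, rfl⟩ := y.exists_lift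
    obtain ⟨k, ζ, rfl⟩ := z.exists_lift
    rw [lift_mul, lift_mul, lift_mul, lift_mul, mul_assoc]
    have h := pairing_cocycle b hb p.2 q.2 k.2
    congr 1
    change _ = θ + (η + ζ - 1 / (2 * Real.pi) * pairing b q.1 k.1) -
      1 / (2 * Real.pi) * pairing b p.1 (q.1 * k.1)
    change θ + η - 1 / (2 * Real.pi) * pairing b p.1 q.1 + ζ -
      1 / (2 * Real.pi) * pairing b (p.1 * q.1) k.1 = _
    linear_combination (-(1 / (2 * Real.pi))) * h
  · obtain ⟨p, θ, rfl⟩ := x.exists_lift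
    rw [← lift_one, lift_mul, one_mul]
    have h := pairing_one_left (b := b) p.1
    congr 1
    change 0 + θ - 1 / (2 * Real.pi) * pairing b 1 p.1 = θ
    rw [h]; ring
  · obtain ⟨p, θ, rfl⟩ := x.exists_lift
    rw [lift_inv', lift_mul, inv_mul_cancel, ← lift_one]
    congr 1
    ring

/-- This is the cocycle identity at `p, p⁻¹, p`, whose other two terms involve the trivial map. -/
lemma pairing_inv_comm (hb : ∀ (g : G) X Y, b (AdL E g X) (AdL E g Y) = b X Y)
    {p : unitInterval → unitInterval → G} (hp : Smooth₂ E p) :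
    pairing b p⁻¹ p = pairing b p p⁻¹ := by
  have hi : Smooth₂ E p⁻¹ := ContMDiffOn.inv hp
  have h := pairing_cocycle b hb hp hi hp
  rw [mul_inv_cancel, inv_mul_cancel, pairing_one_left, pairing_one_right] at h
  linarith

lemma lift_inv (p : smoothSquare E G) (θ : ℝ) :
    (lift b hb p θ)⁻¹ =
      lift b hb p⁻¹ (-θ + 1 / (2 * Real.pi) * pairing b p.1 (p.1)⁻¹) := by
  rw [lift_inv', ← pairing_inv_comm hb p.2]
  rfl

end SquareExt

/-! ### Discs -/

section discs

variable {b : E →L[ℝ] E →L[ℝ] ℝ}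

omit [Group G] [LieGroup 𝓘(ℝ, E) ∞ G] in
lemma Smooth₂.const_fst {f : unitInterval → unitInterval → G} (hf : Smooth₂ E f) :
    Smooth₃ E (fun _ => f) :=
  ContMDiffOn.comp (g := fun x : ℝ × ℝ => f (pr x.1) (pr x.2)) (t := square) hf
    (contDiff_snd.contMDiff (n := ∞)).contMDiffOn (fun _ hx => hx.2)

lemma kacMoodyIntegral_const {f : unitInterval → unitInterval → G} (hf : Smooth₂ E f) :
    kacMoodyIntegral b (fun _ => f) = 0 := by
  refine (cubeIntegral_congr (v := fun _ => 0) fun τ hτ s hs r hr => ?_).trans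
    (by simp [cubeIntegral])
  rw [← (hf.const_fst.leftLog_fst (Set.Ioo_subset_Icc_self hτ) (Set.Ioo_subset_Icc_self hs)
    (Set.Ioo_subset_Icc_self hr)).1, leftLog_const]
  simp

lemma IsDisc.mul {D₁ D₂ : unitInterval → unitInterval → unitInterval → G}
    {f₁ f₂ : unitInterval → unitInterval → G} (h₁ : IsDisc (E := E) D₁ f₁)
    (h₂ : IsDisc (E := E) D₂ f₂) : IsDisc (E := E) (D₁ * D₂) (f₁ * f₂) where
  smooth := ContMDiffOn.mul h₁.smooth h₂.smooth
  loop_zero τ s := by simp [h₁.loop_zero, h₂.loop_zero]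
  loop_one τ s := by simp [h₁.loop_one, h₂.loop_one]
  base s r := by simp [h₁.base, h₂.base]
  boundary s r := by simp [h₁.boundary, h₂.boundary]
  left τ r := by simp [h₁.left, h₂.left]
  right τ r := by simp [h₁.right, h₂.right]

lemma IsDisc.inv {D : unitInterval → unitInterval → unitInterval → G}
    {f : unitInterval → unitInterval → G} (h : IsDisc (E := E) D f) :
    IsDisc (E := E) D⁻¹ f⁻¹ where
  smooth := ContMDiffOn.inv h.smooth
  loop_zero τ s := by simp [h.loop_zero]
  loop_one τ s := by simp [h.loop_one]
  base s r := by simp [h.base]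
  boundary s r := by simp [h.boundary]
  left τ r := by simp [h.left]
  right τ r := by simp [h.right]

lemma IsDisc.conj {D : unitInterval → unitInterval → unitInterval → G}
    {f h : unitInterval → unitInterval → G} (hD : IsDisc (E := E) D f) (hh : Smooth₂ E h) :
    IsDisc (E := E) ((fun _ => h) * D * fun _ => h⁻¹) (h * f * h⁻¹) where
  smooth := ContMDiffOn.mul (ContMDiffOn.mul hh.const_fst hD.smooth)
    (Smooth₂.const_fst (ContMDiffOn.inv hh))
  loop_zero τ s := by simp [hD.loop_zero]
  loop_one τ s := by simp [hD.loop_one]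
  base s r := by simp [hD.base]
  boundary s r := by simp [hD.boundary]
  left τ r := by simp [hD.left]
  right τ r := by simp [hD.right]

omit [LieGroup 𝓘(ℝ, E) ∞ G] in
lemma smooth₃_one : Smooth₃ E (1 : unitInterval → unitInterval → unitInterval → G) :=
  contMDiffOn_const

omit [LieGroup 𝓘(ℝ, E) ∞ G] in
lemma isDisc_one : IsDisc (E := E) (1 : unitInterval → unitInterval → unitInterval → G) 1 :=
  ⟨smooth₃_one, fun _ _ => rfl, fun _ _ => rfl, fun _ _ => rfl, fun _ _ => rfl, fun _ _ => rfl,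
    fun _ _ => rfl⟩

variable (hs : ∀ X Y, b X Y = b Y X) (hb : ∀ (g : G) X Y, b (AdL E g X) (AdL E g Y) = b X Y)
include hs hb

/-- On the faces `s = 0`, `s = 1` and `τ = 0` the discs are trivial. The surviving face `τ = 1`
gives the correction made by the product of `SquareExt`. -/
lemma IsDisc.kacMoodyIntegral_mul {D₁ D₂ : unitInterval → unitInterval → unitInterval → G}
    {f₁ f₂ : unitInterval → unitInterval → G} (h₁ : IsDisc (E := E) D₁ f₁)
    (h₂ : IsDisc (E := E) D₂ f₂) :
    kacMoodyIntegral b (D₁ * D₂) =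
      kacMoodyIntegral b D₁ + kacMoodyIntegral b D₂ - pairing b f₁ f₂ := by
  rw [StringTwoGroup.kacMoodyIntegral_mul hs hb h₁.smooth h₂.smooth (by simp [h₂.loop_zero])
    (by simp [h₂.loop_one]),
    show (fun τ => D₁ τ 1) = 1 from funext fun τ => funext (h₁.right τ),
    show (fun τ => D₁ τ 0) = 1 from funext fun τ => funext (h₁.left τ),
    show D₁ 0 = 1 from funext fun τ => funext (h₁.base τ),
    show D₁ 1 = f₁ from funext fun τ => funext (h₁.boundary τ),
    show D₂ 1 = f₂ from funext fun τ => funext (h₂.boundary τ)]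
  simp only [SquareExt.pairing_one_left]
  ring

lemma IsDisc.kacMoodyIntegral_inv {D : unitInterval → unitInterval → unitInterval → G}
    {f : unitInterval → unitInterval → G} (h : IsDisc (E := E) D f) :
    kacMoodyIntegral b D⁻¹ = -kacMoodyIntegral b D + pairing b f f⁻¹ := by
  have h1 := h.kacMoodyIntegral_mul hs hb h.inv
  rw [mul_inv_cancel, show (1 : unitInterval → unitInterval → unitInterval → G) = fun _ => 1 from
    rfl, kacMoodyIntegral_const (smoothSquare E G).one_mem] at h1
  linarith

/-- Cubes constant in `τ` have integral zero, so conjugation changes the integral by face terms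
only. No boundary condition on `h` is imposed, so that paths in `G` constant in `s` are covered as
well. -/
lemma IsDisc.kacMoodyIntegral_conj {D : unitInterval → unitInterval → unitInterval → G}
    {f h : unitInterval → unitInterval → G} (hD : IsDisc (E := E) D f) (hh : Smooth₂ E h) :
    kacMoodyIntegral b ((fun _ => h) * D * fun _ => h⁻¹) =
      kacMoodyIntegral b D - pairing b h f - pairing b (h * f) h⁻¹ + pairing b h h⁻¹ := by
  have hi : Smooth₂ E h⁻¹ := ContMDiffOn.inv hh
  have hhD : Smooth₃ E ((fun _ => h) * D) := ContMDiffOn.mul hh.const_fst hD.smooth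
  rw [StringTwoGroup.kacMoodyIntegral_mul hs hb hhD hi.const_fst
    (fun _ _ => rfl) (fun _ _ => rfl),
    StringTwoGroup.kacMoodyIntegral_mul hs hb hh.const_fst hD.smooth (by simp [hD.loop_zero])
    (by simp [hD.loop_one]), kacMoodyIntegral_const hh, kacMoodyIntegral_const hi]
  have e0 : D 0 = 1 := funext fun τ => funext (hD.base τ)
  have e1 : D 1 = f := funext fun τ => funext (hD.boundary τ)
  have l0 : ∀ τ, D τ 0 = 1 := fun τ => funext (hD.left τ)
  have l1 : ∀ τ, D τ 1 = 1 := fun τ => funext (hD.right τ)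
  simp only [Pi.mul_apply, e0, e1, l0, l1, pairing_const_left, SquareExt.pairing_one_right, mul_one]
  ring

/-- The boundary of the disc `K f K⁻¹ f⁻¹` for a homotopy `K` with `K(0) = 1`, and the integral over
it. -/
lemma isDisc_commutator {K : unitInterval → unitInterval → unitInterval → G}
    {f : unitInterval → unitInterval → G} (hK : Smooth₃ E K) (hf : Smooth₂ E f)
    (K0 : K 0 = 1) (Kr : ∀ τ, K τ 1 = 1) (Kz : ∀ τ s, K τ s 0 = 1) (Ko : ∀ τ s, K τ s 1 = 1)
    (fl : f 0 = 1) :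
    IsDisc (E := E) ((K * fun _ => f) * (K⁻¹ * fun _ => f⁻¹)) (K 1 * f * ((K 1)⁻¹ * f⁻¹)) ∧
    kacMoodyIntegral b ((K * fun _ => f) * (K⁻¹ * fun _ => f⁻¹)) =
      pairing b (K 1) (K 1)⁻¹ + pairing b f f⁻¹ - pairing b (K 1) f - pairing b (K 1)⁻¹ f⁻¹ -
        pairing b (K 1 * f) ((K 1)⁻¹ * f⁻¹) := by
  have hi : Smooth₂ E f⁻¹ := ContMDiffOn.inv hf
  have hKi : Smooth₃ E K⁻¹ := ContMDiffOn.inv hK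
  have hKf : Smooth₃ E (K * fun _ => f) := ContMDiffOn.mul hK hf.const_fst
  have hKfi : Smooth₃ E (K⁻¹ * fun _ => f⁻¹) := ContMDiffOn.mul hKi hi.const_fst
  refine ⟨⟨ContMDiffOn.mul hKf hKfi, fun τ s => by simp [Kz], fun τ s => by simp [Ko],
    fun s r => by simp [K0], fun s r => rfl, fun τ r => by simp [fl], fun τ r => by simp [Kr]⟩, ?_⟩
  -- The integral of `K` and the `pairing` of `K` with `K⁻¹` on the face `s = 0` need not vanish.
  -- They cancel: since `f` is trivial at `s = 0`, the same face term occurs in `i1` and in `i4`.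
  have i1 := kacMoodyIntegral_mul hs hb hK hKi (by simp [Kz]) (by simp [Ko])
  rw [mul_inv_cancel, show (1 : unitInterval → unitInterval → unitInterval → G) = fun _ => 1 from
    rfl, kacMoodyIntegral_const (smoothSquare E G).one_mem] at i1
  have i2 := kacMoodyIntegral_mul hs hb hK hf.const_fst (fun _ _ => rfl) (fun _ _ => rfl)
  have i3 := kacMoodyIntegral_mul hs hb hKi hi.const_fst (fun _ _ => rfl) (fun _ _ => rfl)
  have i4 := kacMoodyIntegral_mul hs hb hKf hKfi (by simp [Kz]) (by simp [Ko])
  rw [kacMoodyIntegral_const hf] at i2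
  rw [kacMoodyIntegral_const hi] at i3
  have c2 : ∀ q, pairing b q (fun _ => (1 : unitInterval → G)) = 0 := fun q =>
    pairing_const_right b q 1
  simp only [Pi.mul_apply, Pi.inv_apply, K0, Kr, fl, inv_one, mul_one, one_mul, pairing_const_left,
    SquareExt.pairing_one_left, SquareExt.pairing_one_right, c2] at i1 i2 i3 i4
  linarith

end discs

end SquareExtension

/-! ### Actions realised by conjugation, and actions on quotients. -/

section Abstract

variable {H P S : Type*} [Group H] [Group P] [Group S]

/-- Conjugation satisfies every law of an action by automorphisms, and injectivity of `ι` reflects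
these laws back to `act`. -/
lemma exists_mulAut_of_conj (ι : H →* S) (hι : Function.Injective ι) (c : P →* S)
    (act : P → H → H) (h : ∀ g x, ι (act g x) = c g * ι x * (c g)⁻¹) :
    ∃ α : P →* MulAut H, ∀ g x, α g x = act g x := by
  let _ : MulDistribMulAction P H :=
    { smul := act
      one_smul := fun x => hι ((h 1 x).trans (by simp))
      mul_smul := fun g k x => hι <| by
        change ι (act (g * k) x) = ι (act g (act k x))
        simp [h, mul_assoc]
      smul_one := fun g => hι ((h g 1).trans (by simp))
      smul_mul := fun g x y => hι <| by
        change ι (act g (x * y)) = ι (act g x * act g y)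
        simp [h, mul_assoc] }
  exact ⟨MulDistribMulAction.toMulAut P H, fun _ _ => rfl⟩

lemma exists_quotient_action (α : P →* MulAut H) (N : Subgroup H) [N.Normal]
    (hN : ∀ g, ∀ x ∈ N, α g x ∈ N) :
    ∃ β : P →* MulAut (H ⧸ N), ∀ g (x : H),
      β g (QuotientGroup.mk x) = QuotientGroup.mk (α g x) := by
  let _ : MulDistribMulAction P (H ⧸ N) :=
    { smul := fun g => QuotientGroup.map N N (α g).toMonoidHom (hN g)
      one_smul := fun x => QuotientGroup.induction_on x fun x =>
        congrArg QuotientGroup.mk (by simp : α 1 x = x)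
      mul_smul := fun g k x => QuotientGroup.induction_on x fun x =>
        congrArg QuotientGroup.mk (by simp : α (g * k) x = α g (α k x))
      smul_one := fun g => map_one _
      smul_mul := fun g => map_mul _ }
  exact ⟨MulDistribMulAction.toMulAut P (H ⧸ N), fun _ _ => rfl⟩

end Abstract

/-! ### The normal subgroup of discs and the Peiffer relation. -/

section DiscSubgroup

variable {E : Type*} [NormedAddCommGroup E] [NormedSpace ℝ E]
  {G : Type*} [TopologicalSpace G] [ChartedSpace E G] [Group G] [LieGroup 𝓘(ℝ, E) ∞ G]
  {b : E →L[ℝ] E →L[ℝ] ℝ}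

open SquareExt

/-- The subgroup of the elements `(f, exp(∫_D ω))`, for discs `D` with boundary `f`. -/
def discSubgroup (hs : ∀ X Y, b X Y = b Y X)
    (hb : ∀ (g : G) X Y, b (AdL E g X) (AdL E g Y) = b X Y) : Subgroup (SquareExt b hb) where
  carrier := {x | ∃ D, IsDisc (E := E) D x.path.1 ∧
    x = lift b hb x.path (1 / (2 * Real.pi) * kacMoodyIntegral b D)}
  one_mem' := ⟨1, isDisc_one, by
    rw [show (1 : unitInterval → unitInterval → unitInterval → G) = fun _ => 1 from rfl,
      kacMoodyIntegral_const (smoothSquare E G).one_mem, mul_zero]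
    exact lift_one.symm⟩
  mul_mem' := by
    rintro x y ⟨D, hD, hx⟩ ⟨D', hD', hy⟩
    refine ⟨D * D', hD.mul hD', ?_⟩
    rw [hD.kacMoodyIntegral_mul hs hb hD']
    conv_lhs => rw [hx, hy]
    rw [lift_mul]
    exact congrArg (lift b hb _) (by ring)
  inv_mem' := by
    rintro x ⟨D, hD, hx⟩
    refine ⟨D⁻¹, hD.inv, ?_⟩
    rw [hD.kacMoodyIntegral_inv hs hb]
    conv_lhs => rw [hx]
    rw [lift_inv]
    exact congrArg (lift b hb _) (by ring)

variable {hs : ∀ X Y, b X Y = b Y X}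
  {hb : ∀ (g : G) X Y, b (AdL E g X) (AdL E g Y) = b X Y}

lemma lift_mem_discSubgroup {p : smoothSquare E G} {θ : ℝ}
    {D : unitInterval → unitInterval → unitInterval → G} (hD : IsDisc (E := E) D p.1)
    (hθ : θ = 1 / (2 * Real.pi) * kacMoodyIntegral b D) :
    lift b hb p θ ∈ discSubgroup hs hb :=
  ⟨D, hD, congrArg (lift b hb p) hθ⟩

lemma mem_discSubgroup {x : SquareExt b hb} : x ∈ discSubgroup hs hb ↔
    ∃ D, IsDisc (E := E) D x.path.1 ∧
      x.phase = Circle.exp (1 / (2 * Real.pi) * kacMoodyIntegral b D) :=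
  exists_congr fun _ => and_congr_right fun _ =>
    ⟨fun h => congrArg SquareExt.phase h, fun h => SquareExt.ext rfl h⟩

instance : (discSubgroup hs hb).Normal where
  conj_mem := by
    rintro x ⟨D, hD, hx⟩ y
    obtain ⟨q, η, rfl⟩ := y.exists_lift
    rw [hx, lift_inv, lift_mul, lift_mul]
    refine lift_mem_discSubgroup (hD.conj q.2) ?_
    rw [hD.kacMoodyIntegral_conj hs hb q.2]
    change η + _ - _ * pairing b q.1 x.path.1 + (-η + _ * pairing b q.1 (q.1)⁻¹) -
      _ * pairing b (q.1 * x.path.1) (q.1)⁻¹ = _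
    ring

/-- Commutators with elements whose path is null-homotopic relative to `s = 1`. -/
lemma commutator_mem_discSubgroup {K : unitInterval → unitInterval → unitInterval → G}
    (hK : Smooth₃ E K) (K0 : K 0 = 1) (Kr : ∀ τ, K τ 1 = 1) (Kz : ∀ τ s, K τ s 0 = 1)
    (Ko : ∀ τ s, K τ s 1 = 1) (u x : SquareExt b hb) (hu : u.path.1 = K 1) (hx : x.path.1 0 = 1) :
    u * x * (u⁻¹ * x⁻¹) ∈ discSubgroup hs hb := by
  obtain ⟨k, θ, rfl⟩ := u.exists_lift
  obtain ⟨f, η, rfl⟩ := x.exists_lift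
  obtain ⟨h1, h2⟩ := isDisc_commutator hs hb hK f.2 K0 Kr Kz Ko hx
  replace hu : k.1 = K 1 := hu
  rw [← hu] at h1 h2
  rw [lift_inv, lift_inv, lift_mul, lift_mul, lift_mul]
  refine lift_mem_discSubgroup h1 ?_
  rw [h2]
  change θ + η - _ * pairing b k.1 f.1 + (-θ + _ * pairing b k.1 (k.1)⁻¹ +
    (-η + _ * pairing b f.1 (f.1)⁻¹) - _ * pairing b (k.1)⁻¹ (f.1)⁻¹) -
    _ * pairing b (k.1 * f.1) ((k.1)⁻¹ * (f.1)⁻¹) = _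
  ring

/-- The homotopy `f(s)⁻¹ f(s + τ(1 - s))` from the constant path `1` to `f(s)⁻¹ f(1)`. -/
lemma Smooth₂.endHomotopy {f : unitInterval → unitInterval → G} (hf : Smooth₂ E f) :
    Smooth₃ E (fun τ s r => (f s r)⁻¹ * f (pr (s + τ * (1 - s))) r) := by
  refine ContMDiffOn.mul (ContMDiffOn.inv hf.const_fst) ?_
  have h : ContMDiffOn 𝓘(ℝ, ℝ × ℝ × ℝ) 𝓘(ℝ, E) ∞ (fun x : ℝ × ℝ × ℝ =>
      f (pr (x.2.1 + x.1 * (1 - x.2.1))) (pr x.2.2)) cube := by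
    refine ContMDiffOn.comp (g := fun x : ℝ × ℝ => f (pr x.1) (pr x.2)) (t := square) hf
      (f := fun x : ℝ × ℝ × ℝ => (x.2.1 + x.1 * (1 - x.2.1), x.2.2))
      (ContDiff.contMDiff (by fun_prop)).contMDiffOn (fun x hx => ⟨⟨?_, ?_⟩, hx.2.2⟩)
    -- The reparametrisation `s + τ(1 - s)` stays in `[0,1]`, because `1 - (s + τ(1 - s)) = (1 -
    -- τ)(1 - s)`.
    · have := mul_nonneg hx.1.1 (sub_nonneg.2 hx.2.1.2)
      linarith [hx.2.1.1]
    · have := mul_nonneg (sub_nonneg.2 hx.1.2) (sub_nonneg.2 hx.2.1.2)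
      simp only
      linarith
  exact h.congr fun x hx => by rw [coe_pr hx.1, coe_pr hx.2.1]

/-- The Peiffer relation: conjugation by an element of the extension over a path `f` agrees, modulo
discs, with conjugation by an element over the endpoint of `f`. -/
lemma conj_div_conj_mem_discSubgroup (a x y : SquareExt b hb)
    (hxz : ∀ s, x.path.1 s 0 = 1) (hxo : ∀ s, x.path.1 s 1 = 1)
    (ha : ∀ s, a.path.1 s = x.path.1 1) (hy : y.path.1 0 = 1) :
    (a * y * a⁻¹)⁻¹ * (x * y * x⁻¹) ∈ discSubgroup hs hb := by
  have h := commutator_mem_discSubgroup (hs := hs) (hb := hb)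
    (Smooth₂.endHomotopy (E := E) x.path.2)
    (by funext s r; simp) (fun τ => by funext r; simp) (fun τ s => by simp [hxz])
    (fun τ s => by simp [hxo]) (x⁻¹ * a) y
    (by
      funext s r
      change (x.path.1 s r)⁻¹ * a.path.1 s r = _
      simp [ha]) hy
  -- Conjugating the inverse of the commutator of `x⁻¹a` and `y` by `x y⁻¹` gives `a y⁻¹ a⁻¹ x y
  -- x⁻¹`, the required element.
  have h2 := (inferInstance : (discSubgroup hs hb).Normal).conj_mem _ (inv_mem h) (x * y⁻¹)
  convert h2 using 1
  group

end DiscSubgroup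

/-! ### Embedding the extension and `P₀G` into the large group. -/

section Extension

variable {E : Type*} [NormedAddCommGroup E] [NormedSpace ℝ E] [FiniteDimensional ℝ E]
  {G : Type*} [TopologicalSpace G] [ChartedSpace E G] [Group G] [LieGroup 𝓘(ℝ, E) ∞ G]
  (B : LinearMap.BilinForm ℝ (GroupLieAlgebra 𝓘(ℝ, E) G)) (hAd : AdInvariant B)

open SquareExt

/-- The elements of the extension, without their boundary conditions. -/
def toSquareExt (x : Ext E G) : SquareExt (formCLM B) (formCLM_invariant hAd) :=
  ⟨⟨x.path.1, x.path.2.1⟩, x.phase⟩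

lemma toSquareExt_injective : Function.Injective (toSquareExt B hAd) := fun x y h => by
  have h1 := congrArg (fun z => z.path.1) h
  have h2 := congrArg SquareExt.phase h
  exact Ext.ext (Subtype.ext h1) h2

lemma toSquareExt_extMul (x y : Ext E G) :
    toSquareExt B hAd (extMul B x y) = toSquareExt B hAd x * toSquareExt B hAd y := rfl

include hAd in
lemma exists_extGroup : ∃ _ : Group (Ext E G), ∀ x y : Ext E G, x * y = extMul B x y := by
  let _ : Mul (Ext E G) := ⟨extMul B⟩
  let _ : One (Ext E G) := ⟨⟨1, 1⟩⟩
  -- The inverse path still satisfies the boundary conditions; the phase is read off from the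
  -- inverse in the large group.
  let _ : Inv (Ext E G) := ⟨fun x => ⟨x.path⁻¹, (toSquareExt B hAd x)⁻¹.phase⟩⟩
  have hmul : ∀ x y : Ext E G, toSquareExt B hAd (x * y) =
    toSquareExt B hAd x * toSquareExt B hAd y := fun _ _ => rfl
  have hone : toSquareExt B hAd (1 : Ext E G) = 1 := rfl
  have hinv : ∀ x : Ext E G, toSquareExt B hAd x⁻¹ = (toSquareExt B hAd x)⁻¹ := fun _ => rfl
  refine ⟨Group.ofLeftAxioms (fun x y z => ?_) (fun x => ?_) (fun x => ?_), fun _ _ => rfl⟩ <;>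
    apply toSquareExt_injective B hAd <;> simp [hmul, hone, hinv, mul_assoc]

/-- Paths in `G`, as elements of the extension that are constant in `s`. -/
def constExt : P₀ E G →* SquareExt (formCLM B) (formCLM_invariant hAd) where
  toFun g := lift _ _ ⟨fun _ => g.1, g.2.1.const_left⟩ 0
  map_one' := lift_one
  map_mul' g h := by
    rw [lift_mul]
    change _ = lift _ _ _ (0 + 0 - 1 / (2 * Real.pi) * pairing (formCLM B) (fun _ => g.1) _)
    rw [pairing_const_left, mul_zero, sub_zero, add_zero]
    rfl

/-- The right logarithmic derivative of `g⁻¹` is minus the left one of `g`. The exponent of the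
action is thereby a value of the cocycle exponent, which makes it comparable with a conjugation. -/
lemma squareIntegral_leftLog (g : P₀ E G) (f : P₀L₀ E G) :
    squareIntegral (fun y => formCLM B (leftLogE E (fun s' => f.1 s' (pr y.1)) y.2)
      (leftLogE E g.1 y.1)) = -pairing (formCLM B) f.1 (fun _ => (g.1)⁻¹) := by
  rw [pairing, ← squareIntegral_neg]
  refine squareIntegral_congr fun r hr s hs => ?_
  have h := rightLog_inv g.2.1 (Set.Ioo_subset_Icc_self hr)
  change _ = -(formCLM B _ (rightLogE E (fun u => (g.1 u)⁻¹) r))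
  rw [h, map_neg, neg_neg]

lemma integral_xi (g : P₀ E G) (f : P₀L₀ E G) :
    ∫ s in (0 : ℝ)..1, xi B g.1 (fun r => leftLog (fun s' => f.1 s' (pr r)) s) =
      1 / (2 * Real.pi) * squareIntegral (fun y => formCLM B
        (leftLogE E (fun s' => f.1 s' (pr y.1)) y.2) (leftLogE E g.1 y.1)) := by
  have hc : ContinuousOn (fun y : ℝ × ℝ => formCLM B
      (leftLogE E (fun s' => f.1 s' (pr y.1)) y.2) (leftLogE E g.1 y.1)) square := by
    have hi : Smooth₂ E (fun _ => (g.1)⁻¹) := Smooth₁.const_left (ContMDiffOn.inv g.2.1)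
    refine (continuousOn_pairing (formCLM B) f.2.1 hi).neg.congr fun y hy => ?_
    have h := rightLog_inv g.2.1 hy.1
    change _ = -(formCLM B _ (rightLogE E (fun u => (g.1 u)⁻¹) y.1))
    rw [h, map_neg, neg_neg]
  rw [squareIntegral_swap hc]
  simp only [xi]
  rw [intervalIntegral.integral_const_mul]
  rfl

lemma toSquareExt_extAct (g : P₀ E G) (x : Ext E G) :
    toSquareExt B hAd (extAct B g x) =
      constExt B hAd g * toSquareExt B hAd x * (constExt B hAd g)⁻¹ := by
  obtain ⟨θ, hθ⟩ := Circle.exp_surjective x.phase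
  have e1 : toSquareExt B hAd x = lift _ _ ⟨x.path.1, x.path.2.1⟩ θ := SquareExt.ext rfl hθ.symm
  have hg : Smooth₂ E (fun _ => g.1) := g.2.1.const_left
  have hi : Smooth₂ E (fun _ => g.1)⁻¹ := ContMDiffOn.inv hg
  -- The cocycle identity at `g, f, g⁻¹`. Since `g` is constant in `s`, pairings with `g` on the
  -- left vanish, leaving `pairing (g f) g⁻¹ = pairing f g⁻¹`.
  have h := pairing_cocycle (formCLM B) (formCLM_invariant hAd) hg x.path.2.1 hi
  have h0 : ∀ q, pairing (formCLM B) (fun _ => g.1) q = 0 := pairing_const_left _ _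
  rw [h0, h0, zero_add, add_zero] at h
  change _ = lift _ _ ⟨fun _ => g.1, _⟩ 0 * _ * (lift _ _ ⟨fun _ => g.1, _⟩ 0)⁻¹
  rw [e1, lift_inv, lift_mul, lift_mul]
  refine SquareExt.ext rfl ?_
  change x.phase * Circle.exp _ = Circle.exp (0 + θ - _ * pairing (formCLM B) (fun _ => g.1) x.path.1
    + (-0 + _ * pairing (formCLM B) (fun _ => g.1) _) -
    _ * pairing (formCLM B) ((fun _ => g.1) * x.path.1) (fun _ => g.1)⁻¹)
  rw [integral_xi, squareIntegral_leftLog, h0, h0, h, ← hθ, ← Circle.exp_add]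
  congr 1
  change _ + _ * -pairing (formCLM B) x.path.1 (fun _ => g.1)⁻¹ = _
  ring

lemma mem_setN_iff (hs : ∀ X Y, formCLM B X Y = formCLM B Y X) (x : Ext E G) :
    x ∈ setN B ↔ toSquareExt B hAd x ∈ discSubgroup hs (formCLM_invariant hAd) := by
  rw [mem_discSubgroup]
  constructor
  · rintro ⟨-, D, hD, h⟩
    exact ⟨D, hD, by rw [← discIntegral_eq B hD.smooth]; exact h⟩
  · rintro ⟨D, hD, h⟩
    refine ⟨Subtype.ext (funext fun r => ?_), D, hD, by rw [discIntegral_eq B hD.smooth]; exact h⟩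
    -- A disc is trivial on the edge `s = 1`, so its boundary automatically ends at the trivial
    -- loop.
    exact (hD.boundary 1 r).symm.trans (hD.right 1 r)

end Extension

end StringTwoGroup

end

theorem mainTheorem5
    {E : Type*} [NormedAddCommGroup E] [NormedSpace ℝ E] [FiniteDimensional ℝ E]
    {G : Type*} [TopologicalSpace G] [ChartedSpace E G] [Group G] [LieGroup 𝓘(ℝ, E) ∞ G]
    (B : LinearMap.BilinForm ℝ (GroupLieAlgebra 𝓘(ℝ, E) G))
    (hB : ∀ X Y, B X Y = B Y X) (hAd : StringTwoGroup.AdInvariant B) :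
    -- the second expression for the action, as a double integral
    (∀ (g : StringTwoGroup.P₀ E G) (x : StringTwoGroup.Ext E G),
      StringTwoGroup.extAct B g x =
        ⟨StringTwoGroup.conj g x.path, x.phase * Circle.exp (1 / (2 * Real.pi) *
          ∫ r in (0 : ℝ)..1, ∫ s in (0 : ℝ)..1,
            B (StringTwoGroup.leftLog (fun s' => x.path.1 s' (StringTwoGroup.pr r)) s)
              (StringTwoGroup.leftLog g.1 r))⟩) ∧
    -- the cocycle product is a group law
    ∃ _ : Group (StringTwoGroup.Ext E G),
      (∀ x y : StringTwoGroup.Ext E G, x * y = StringTwoGroup.extMul B x y) ∧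
      -- the formula for the action defines an action by group automorphisms
      ∃ α : StringTwoGroup.P₀ E G →* MulAut (StringTwoGroup.Ext E G),
        (∀ g x, α g x = StringTwoGroup.extAct B g x) ∧
        -- `N` is a normal subgroup, and the action closes on it
        ∃ (N : Subgroup (StringTwoGroup.Ext E G)) (_ : N.Normal),
          (N : Set (StringTwoGroup.Ext E G)) = StringTwoGroup.setN B ∧
          (∀ g, ∀ x ∈ N, α g x ∈ N) ∧
          -- the induced action on the quotient and `t = ♭` form a crossed module
          ∃ C : StringTwoGroup.CrossedModule (StringTwoGroup.Ext E G ⧸ N) (StringTwoGroup.P₀ E G),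
            (∀ (g : StringTwoGroup.P₀ E G) (x : StringTwoGroup.Ext E G),
              C.act g (QuotientGroup.mk x) = QuotientGroup.mk (α g x)) ∧
            (∀ x : StringTwoGroup.Ext E G,
              C.t (QuotientGroup.mk x) =
                Subgroup.inclusion (StringTwoGroup.L₀_le_P₀ E G)
                  (StringTwoGroup.flat E G x.path)) := by
  open StringTwoGroup in
  have hs : ∀ X Y, formCLM B X Y = formCLM B Y X := hB
  refine ⟨fun g x => Ext.ext rfl ?_, ?_⟩
  · change _ * Circle.exp _ = _
    rw [integral_xi]
    rfl
  obtain ⟨hG, hmul⟩ := exists_extGroup B hAd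
  let ι : Ext E G →* SquareExt (formCLM B) (formCLM_invariant hAd) :=
    MonoidHom.mk' (toSquareExt B hAd) fun x y => by rw [hmul, toSquareExt_extMul]
  obtain ⟨α, hα⟩ := exists_mulAut_of_conj ι (toSquareExt_injective B hAd) (constExt B hAd)
    (extAct B) (toSquareExt_extAct B hAd)
  have hια : ∀ g x, ι (α g x) = constExt B hAd g * ι x * (constExt B hAd g)⁻¹ := fun g x => by
    rw [hα]
    exact toSquareExt_extAct B hAd g x
  let N : Subgroup (Ext E G) := (discSubgroup hs (formCLM_invariant hAd)).comap ι
  have hN : (N : Set (Ext E G)) = setN B :=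
    Set.ext fun x => (mem_setN_iff B hAd hs x).symm
  have hαN : ∀ g, ∀ x ∈ N, α g x ∈ N := fun g x hx => by
    change ι (α g x) ∈ discSubgroup hs _
    rw [hια]
    exact (inferInstance : (discSubgroup hs _).Normal).conj_mem _ hx _
  have hNn : N.Normal := inferInstance
  refine ⟨hG, hmul, α, hα, N, hNn, hN, hαN, ?_⟩
  obtain ⟨β, hβ⟩ := exists_quotient_action α N hαN
  let t₀ : Ext E G →* P₀ E G := (Subgroup.inclusion (L₀_le_P₀ E G)).comp
    ((flat E G).comp (MonoidHom.mk' Ext.path fun x y => by rw [hmul]; rfl))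
  let t : Ext E G ⧸ N →* P₀ E G := QuotientGroup.lift N t₀ fun x hx => by
    have h1 : x ∈ setN B := hN ▸ hx
    change Subgroup.inclusion (L₀_le_P₀ E G) (flat E G x.path) = 1
    rw [h1.1, map_one]
  refine ⟨⟨t, β, fun g h => ?_, fun h₁ h₂ => ?_⟩, hβ, fun _ => rfl⟩
  · induction h using QuotientGroup.induction_on with | _ x
    rw [hβ, hα]
    rfl
  · induction h₁ using QuotientGroup.induction_on with | _ x
    induction h₂ using QuotientGroup.induction_on with | _ y
    change β (t₀ x) (QuotientGroup.mk y) = QuotientGroup.mk (x * y * x⁻¹)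
    rw [hβ, QuotientGroup.eq]
    change ι ((α (t₀ x) y)⁻¹ * (x * y * x⁻¹)) ∈ discSubgroup hs _
    rw [map_mul, map_inv, hια, map_mul, map_mul, map_inv]
    -- The first element is `constExt` of the endpoint loop: its path is constantly `f(1)`, where
    -- `f` is the path of `x`.
    exact conj_div_conj_mem_discSubgroup _ _ _ x.path.2.2.2.1 x.path.2.2.2.2 (fun _ => rfl)
      (funext y.path.2.2.1)
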